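/- Let $\mathcal U$ be a nonempty finite set of controls, let $x_{t+1}=f(x_t,u_t)$ be a sensor with known initial state $x_0\in\mathcal X$, and let $T\ge 0$. The target state evolves by $y_{t+1}=Ay_t+w_t$ with $w_t\sim\mathcal N(0,W)$, and the measurements are $z_t=H(x_t)y_t+v_t(x_t)$ with $v_t(x)\sim\mathcal N(0,V(x))$, $1\le t\le T$, where $W\succeq 0$ and $V(x)\succ 0$ for all $x\in\mathcal X$. The prior is $y_1\sim\mathcal N(m,\Sigma_0)$ with $\Sigma_0\succeq 0$; an initial signal $z_0$ has an arbitrary law; and $y_1$, $z_0$, the $w_t$ and the noise fields $v_t(\cdot)$ are mutually independent. In the active information acquisition problem one chooses measurable feedback policies $u_t=\mu_t(z_{0:t},u_{0:t-1})$, $0\le t\le T-1$, to maximize the conditional mutual information $$\mathbb I(y_{T+1};z_{1:T}\mid x_{1:T}).$$ (i) Some open-loop control sequence $\sigma=(u_0,\dots,u_{T-1})\in\mathcal U^T$ is optimal among all these feedback policies. (ii) Suppose that the unconditional covariance $S$ of $y_{T+1}$ is nonsingular (for $T\ge1$ this holds, for example, if $W\succ0$). Then the problem is equivalent to the deterministic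 optimal control problem $$\min_{\sigma\in\mathcal U^T}\ \log\det\Sigma_T\quad\text{s.t.}\quad x_{t+1}=f(x_t,\sigma_t),\quad \Sigma_{t+1}=\rho_{x_{t+1}}(\Sigma_t),\qquad t=0,\dots,T-1,$$ where $\rho_x=\rho^p\circ\rho^e_x$ is the Kalman filter Riccati map: $\rho^p(\Sigma)=A\Sigma A^\top+W$, $\rho^e_x(\Sigma)=C_x(\Sigma)\Sigma$, $C_x(\Sigma)=I-K_x(\Sigma)H(x)$, $K_x(\Sigma)=\Sigma H(x)^\top R_x(\Sigma)^{-1}$, $R_x(\Sigma)=H(x)\Sigma H(x)^\top+V(x)$. Precisely: for every $\sigma\in\mathcal U^T$ the matrix $\Sigma_T$ is positive definite and the open-loop policy $\sigma$ has the finite objective $\frac12(\log\det S-\log\det\Sigma_T)$; an open-loop $\sigma$ is optimal for the information acquisition problem if and only if it solves the deterministic problem; and under any optimal feedback policy the applied control sequence almost surely solves the deterministic problem. (iii) Let $M(x)=H(x)^\top V(x)^{-1}H(x)$. For all $x$ and all $\Sigma\succeq0$, $R_x(\Sigma)\succ0$, $I+\Sigma M(x)$ is invertible, $C_x(\Sigma)=(I+\Sigma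 M(x))^{-1}$ and $\rho^e_x(\Sigma)=C_x(\Sigma)\Sigma C_x(\Sigma)^\top+K_x(\Sigma)V(x)K_x(\Sigma)^\top$; if $\Sigma\succ0$, then also $\Sigma^{-1}+M(x)\succ0$ and $\rho^e_x(\Sigma)=(\Sigma^{-1}+M(x))^{-1}$. -/

import Mathlib

open MeasureTheory ProbabilityTheory
open scoped ENNReal

namespace ActiveInfo

noncomputable section

/-- `ℝⁿ` with the Euclidean structure. -/
abbrev Vec (n : ℕ) : Type := EuclideanSpace ℝ (Fin n)

/-- The matrix-vector product `B y`. -/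
def act {n k : ℕ} (B : Matrix (Fin k) (Fin n) ℝ) (y : Vec n) : Vec k :=
  WithLp.toLp 2 (B.mulVec y.ofLp)

/-- The conditional mutual information `I(Y; Z ∣ X)`, as the Kullback-Leibler divergence of the
joint law of `(X, (Y, Z))` from the law under which `X` is unchanged and `Y`, `Z` are
conditionally independent given `X`, each with its true conditional distribution. -/
def condMutualInfo {Ω α β γ : Type*} [MeasurableSpace Ω] [MeasurableSpace α]
    [MeasurableSpace β] [StandardBorelSpace β] [Nonempty β]
    [MeasurableSpace γ] [StandardBorelSpace γ] [Nonempty γ]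
    (P : Measure Ω) [IsFiniteMeasure P] (Y : Ω → β) (Z : Ω → γ) (X : Ω → α) : ℝ≥0∞ :=
  InformationTheory.klDiv (P.map fun ω => (X ω, (Y ω, Z ω)))
    ((P.map X).compProd ((condDistrib Y X P).prod (condDistrib Z X P)))

/-- The data of the problem: the sensor motion model `x' = f(x, u)`, the linear target model
`y' = A y + w` with `w ∼ N(0, W)`, and the observation model `z = H(x) y + v(x)` with
`v(x) ∼ N(0, V(x))`. -/
structure Model (𝒳 𝒰 : Type*) (ny nz : ℕ) where
  f : 𝒳 → 𝒰 → 𝒳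
  A : Matrix (Fin ny) (Fin ny) ℝ
  W : Matrix (Fin ny) (Fin ny) ℝ
  H : 𝒳 → Matrix (Fin nz) (Fin ny) ℝ
  V : 𝒳 → Matrix (Fin nz) (Fin nz) ℝ
  posSemidef_W : W.PosSemidef
  posDef_V : ∀ x, (V x).PosDef

/-- The primitive random variables, on the probability space `(Ω, P)`: the target state `y₁`, which
has law `N(m, Sig₀)`, the initial signal `z₀`, the target noises `w k = w_{k+1}`, and the
measurement noises `v k x = v_{k+1}(x)`, for `k = 0, 1, 2, …`.
The dependence of `v_{k+1}(x)` on `x` for a fixed time is arbitrary. -/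
structure Primitives {𝒳 𝒰 : Type*} {ny nz : ℕ} (S : Model 𝒳 𝒰 ny nz) (m : Vec ny)
    (Sig₀ : Matrix (Fin ny) (Fin ny) ℝ) {Ω : Type*} [MeasurableSpace Ω] (P : Measure Ω) where
  y₁ : Ω → Vec ny
  z₀ : Ω → Vec nz
  w : ℕ → Ω → Vec ny
  v : ℕ → 𝒳 → Ω → Vec nz
  measurable_y₁ : Measurable y₁
  measurable_z₀ : Measurable z₀
  measurable_w : ∀ k, Measurable (w k)
  measurable_v : ∀ k x, Measurable (v k x)
  law_y₁ : P.map y₁ = multivariateGaussian m Sig₀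
  law_w : ∀ k, P.map (w k) = multivariateGaussian 0 S.W
  law_v : ∀ k x, P.map (v k x) = multivariateGaussian 0 (S.V x)
  /- All of `y₁, z₀, w_1, w_2, …, v_1(·), v_2(·), …` are mutually independent. -/
  iIndep_w : iIndepFun w P
  iIndep_v : iIndepFun (fun k ω x => v k x ω) P
  indep_w_v : IndepFun (fun ω k => w k ω) (fun ω k x => v k x ω) P
  indep_z₀ : IndepFun z₀ (fun ω => ((fun k => w k ω), (fun k x => v k x ω))) P
  indep_y₁ : IndepFun y₁ (fun ω => (z₀ ω, (fun k => w k ω), (fun k x => v k x ω))) P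

/-- A control policy `(μ_0, …, μ_{T-1})`, where `μ_t` chooses `u_t` from `z_{0:t}` and
`u_{0:t-1}`, measurably in the measurements. -/
structure Policy (𝒰 : Type*) (nz T : ℕ) where
  act : (t : Fin T) → (Fin (t + 1) → Vec nz) → (Fin t → 𝒰) → 𝒰
  measurable_act : ∀ t u a, MeasurableSet {z | act t z u = a}

/-- The open-loop policy that applies the controls `σ_0, …, σ_{T-1}` whatever is measured. -/
def Policy.openLoop {𝒰 : Type*} {nz T : ℕ} (σ : Fin T → 𝒰) : Policy 𝒰 nz T where
  act t _ _ := σ t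
  measurable_act _ _ _ := MeasurableSet.const _

namespace Model

variable {𝒳 𝒰 : Type*} {ny nz : ℕ} (S : Model 𝒳 𝒰 ny nz)

/-- The sensor state `x_t` reached from `x_0` under the controls `u_0, …, u_{t-1}`. -/
def sensorState (x₀ : 𝒳) : (t : ℕ) → (Fin t → 𝒰) → 𝒳
  | 0, _ => x₀
  | t + 1, u => S.f (sensorState x₀ t (Fin.init u)) (u (Fin.last t))

/-- `R_x(Sig) = H(x) Sig H(x)ᵀ + V(x)`. -/
def innovCov (x : 𝒳) (Sig : Matrix (Fin ny) (Fin ny) ℝ) : Matrix (Fin nz) (Fin nz) ℝ :=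
  S.H x * Sig * (S.H x).transpose + S.V x

/-- `K_x(Sig) = Sig H(x)ᵀ R_x(Sig)⁻¹`, the Kalman gain. -/
def gain (x : 𝒳) (Sig : Matrix (Fin ny) (Fin ny) ℝ) : Matrix (Fin ny) (Fin nz) ℝ :=
  Sig * (S.H x).transpose * (S.innovCov x Sig)⁻¹

/-- `C_x(Sig) = I - K_x(Sig) H(x)`. -/
def contraction (x : 𝒳) (Sig : Matrix (Fin ny) (Fin ny) ℝ) : Matrix (Fin ny) (Fin ny) ℝ :=
  1 - S.gain x Sig * S.H x

/-- `M(x) = H(x)ᵀ V(x)⁻¹ H(x)`, the sensor information matrix. -/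
def infoMatrix (x : 𝒳) : Matrix (Fin ny) (Fin ny) ℝ :=
  (S.H x).transpose * (S.V x)⁻¹ * S.H x

/-- The update step `ρᵉ_x(Sig) = C_x(Sig) Sig`. -/
def update (x : 𝒳) (Sig : Matrix (Fin ny) (Fin ny) ℝ) : Matrix (Fin ny) (Fin ny) ℝ :=
  S.contraction x Sig * Sig

/-- The prediction step `ρᵖ(Sig) = A Sig Aᵀ + W`. -/
def predict (Sig : Matrix (Fin ny) (Fin ny) ℝ) : Matrix (Fin ny) (Fin ny) ℝ :=
  S.A * Sig * S.A.transpose + S.W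

/-- The Kalman filter Riccati map `ρ_x = ρᵖ ∘ ρᵉ_x`. -/
def riccati (x : 𝒳) (Sig : Matrix (Fin ny) (Fin ny) ℝ) : Matrix (Fin ny) (Fin ny) ℝ :=
  S.predict (S.update x Sig)

/-- `Sig_t` for the controls `u_0, …, u_{t-1}`: `Sig_{t+1} = ρ_{x_{t+1}}(Sig_t)`. -/
def filterCov (x₀ : 𝒳) (Sig₀ : Matrix (Fin ny) (Fin ny) ℝ) :
    (t : ℕ) → (Fin t → 𝒰) → Matrix (Fin ny) (Fin ny) ℝ
  | 0, _ => Sig₀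
  | t + 1, u => S.riccati (S.sensorState x₀ (t + 1) u) (filterCov x₀ Sig₀ t (Fin.init u))

/-- The unconditional covariance of the target state `y_{t+1}`. -/
def targetCov (Sig₀ : Matrix (Fin ny) (Fin ny) ℝ) (t : ℕ) : Matrix (Fin ny) (Fin ny) ℝ :=
  S.predict^[t] Sig₀

/-- `σ` solves the deterministic problem of minimizing `log det Sig_T` over `𝒰ᵀ`. -/
def IsLogDetOptimal (x₀ : 𝒳) (Sig₀ : Matrix (Fin ny) (Fin ny) ℝ) {T : ℕ} (σ : Fin T → 𝒰) : Prop :=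
  ∀ τ : Fin T → 𝒰,
    Real.log (S.filterCov x₀ Sig₀ T σ).det ≤ Real.log (S.filterCov x₀ Sig₀ T τ).det

end Model

namespace Primitives

variable {𝒳 𝒰 : Type*} {ny nz : ℕ} {S : Model 𝒳 𝒰 ny nz} {m : Vec ny}
  {Sig₀ : Matrix (Fin ny) (Fin ny) ℝ} {Ω : Type*} [MeasurableSpace Ω] {P : Measure Ω}
  (R : Primitives S m Sig₀ P)

/-- `target k` is the target state `y_{k+1}`. -/
def target : ℕ → Ω → Vec ny
  | 0, ω => R.y₁ ω
  | k + 1, ω => act S.A (target k ω) + R.w k ω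

/-- The pair `(z_{0:t}, u_{0:t-1})` produced by the policy `μ` from the initial pose `x₀`. -/
def history (x₀ : 𝒳) {T : ℕ} (μ : Policy 𝒰 nz T) (ω : Ω) :
    (t : ℕ) → t ≤ T → (Fin (t + 1) → Vec nz) × (Fin t → 𝒰)
  | 0, _ => (fun _ => R.z₀ ω, Fin.elim0)
  | t + 1, h =>
    let past := history x₀ μ ω t (Nat.le_of_succ_le h)
    let u : Fin (t + 1) → 𝒰 := Fin.snoc past.2 (μ.act ⟨t, h⟩ past.1 past.2)
    let x : 𝒳 := S.sensorState x₀ (t + 1) u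
    (Fin.snoc past.1 (act (S.H x) (R.target t ω) + R.v t x ω), u)

/-- The controls `u_{0:T-1}` applied under `μ`. -/
def controls (x₀ : 𝒳) {T : ℕ} (μ : Policy 𝒰 nz T) (ω : Ω) : Fin T → 𝒰 :=
  (R.history x₀ μ ω T le_rfl).2

/-- The measurements `z_{1:T}` under `μ`. -/
def measurements (x₀ : 𝒳) {T : ℕ} (μ : Policy 𝒰 nz T) (ω : Ω) : Fin T → Vec nz :=
  Fin.tail (R.history x₀ μ ω T le_rfl).1

/-- The sensor trajectory `x_{1:T}` under `μ`. -/
def trajectory (x₀ : 𝒳) {T : ℕ} (μ : Policy 𝒰 nz T) (ω : Ω) : Fin T → 𝒳 :=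
  fun t => S.sensorState x₀ (t + 1)
    fun i => R.controls x₀ μ ω (Fin.castLE (Nat.succ_le_of_lt t.isLt) i)

/-- The objective `I(y_{T+1}; z_{1:T} ∣ x_{1:T})` under the policy `μ`. -/
def objective [MeasurableSpace 𝒳] [IsProbabilityMeasure P] (x₀ : 𝒳) {T : ℕ}
    (μ : Policy 𝒰 nz T) : ℝ≥0∞ :=
  condMutualInfo P (R.target T) (R.measurements x₀ μ) (R.trajectory x₀ μ)

/-- `μ` is optimal for active information acquisition, among all policies. -/
def IsOptimal [MeasurableSpace 𝒳] [IsProbabilityMeasure P] (x₀ : 𝒳) {T : ℕ}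
    (μ : Policy 𝒰 nz T) : Prop :=
  ∀ μ' : Policy 𝒰 nz T, R.objective x₀ μ' ≤ R.objective x₀ μ

end Primitives

end

end ActiveInfo

/-! Along a fixed sensor trajectory the model is linear and Gaussian, so the error of the Kalman
predictor is a centred Gaussian vector with the Riccati covariance, independent of all signals
received, `z₀` included (`Primitives.error_law`). Feedback does not spoil this. Whether a policy
follows a trajectory `x` is decided by the signals along `x` alone
(`Primitives.preimage_trajectory`), and when it does, these are the signals it actually receives
(`Primitives.measurements_eq`). Hence on each event `X = x` the target is a function of the
measurements plus an independent Gaussian error whose covariance depends on `x` only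
(`Primitives.isGaussianChannel`).

Write `Y`, `Z`, `X` for target, measurements and trajectory. The chain rule `I(Y; X, Z) = I(Y; X) +
I(Y; Z ∣ X)` (`klDiv_decoupledLaw`) bounds the objective by `I(Y; X, Z)`, with equality when `X` is
constant, as for open-loop controls. The density is explicit, and its quadratic terms cancel in the
mean, so `I(Y; X, Z) = E[-½ log det (B Σ_T(X) Bᵀ)]`, where `B` whitens `Y`
(`IsGaussianChannel.klDiv_decoupledLaw`). Thus every policy is worth at most an average of finitely
many open-loop values. A best open-loop sequence is therefore optimal, and an optimal policy almost
surely applies such sequences. When `S` is nonsingular, `det (B Σ Bᵀ) = det Σ / det S`.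

For singular `S` the whitened space has the dimension of the rank of `S`. The values remain finite
because, with `V ≻ 0`, the filter never becomes certain of a direction in which the target is random
(`Model.dotProduct_covAlong_eq_zero`). -/

namespace ActiveInfo

/-! ### Matrix identities of the Riccati map -/

section Riccati

open Matrix

variable {𝒳 𝒰 : Type*} {ny nz : ℕ} (S : Model 𝒳 𝒰 ny nz)

lemma Model.posDef_innovCov (x : 𝒳) {Sig : Matrix (Fin ny) (Fin ny) ℝ} (hS : Sig.PosSemidef) :
    (S.innovCov x Sig).PosDef := by
  have h := hS.mul_mul_conjTranspose_same (S.H x)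
  rw [conjTranspose_eq_transpose_of_trivial] at h
  exact PosDef.posSemidef_add h (S.posDef_V x)

lemma Model.gain_mul_innovCov (x : 𝒳) {Sig : Matrix (Fin ny) (Fin ny) ℝ} (hS : Sig.PosSemidef) :
    S.gain x Sig * S.innovCov x Sig = Sig * (S.H x)ᵀ := by
  have hu := (S.posDef_innovCov x hS).isUnit
  rw [Matrix.isUnit_iff_isUnit_det] at hu
  rw [gain, nonsing_inv_mul_cancel_right _ _ hu]

/-- The filtered error `C e - K v` is uncorrelated with the innovation `H e + v`. -/
lemma Model.contraction_mul_cross (x : 𝒳) {Sig : Matrix (Fin ny) (Fin ny) ℝ}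
    (hS : Sig.PosSemidef) :
    S.contraction x Sig * Sig * (S.H x)ᵀ = S.gain x Sig * S.V x := by
  have h := S.gain_mul_innovCov x hS
  rw [innovCov, Matrix.mul_add] at h
  rw [contraction, Matrix.sub_mul, Matrix.sub_mul, Matrix.one_mul, ← h]
  simp only [Matrix.mul_assoc]
  abel

lemma Model.update_eq_joseph (x : 𝒳) {Sig : Matrix (Fin ny) (Fin ny) ℝ}
    (hS : Sig.PosSemidef) :
    S.update x Sig = S.contraction x Sig * Sig * (S.contraction x Sig)ᵀ +
      S.gain x Sig * S.V x * (S.gain x Sig)ᵀ := by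
  have h : (S.contraction x Sig)ᵀ = 1 - (S.H x)ᵀ * (S.gain x Sig)ᵀ := by
    rw [contraction, transpose_sub, transpose_one, transpose_mul]
  rw [h, Matrix.mul_sub, Matrix.mul_one, ← Matrix.mul_assoc, S.contraction_mul_cross x hS, update]
  abel

/-- Since `V = R - H Σ Hᵀ`, one gets `H C = V R⁻¹ H`, hence `M C = Hᵀ R⁻¹ H` and `Σ M C = K H = 1 -
C`. No inverse of `Σ` is needed. -/
lemma Model.one_add_mul_infoMatrix_mul_contraction (x : 𝒳) {Sig : Matrix (Fin ny) (Fin ny) ℝ}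
    (hS : Sig.PosSemidef) :
    (1 + Sig * S.infoMatrix x) * S.contraction x Sig = 1 := by
  have hV := (Matrix.isUnit_iff_isUnit_det _).1 (S.posDef_V x).isUnit
  have hC : (S.H x)ᵀ * (S.V x)⁻¹ * S.H x * S.contraction x Sig =
      (S.H x)ᵀ * (S.innovCov x Sig)⁻¹ * S.H x := by
    have hu := (Matrix.isUnit_iff_isUnit_det _).1 (S.posDef_innovCov x hS).isUnit
    have h1 : S.H x * S.contraction x Sig = S.V x * ((S.innovCov x Sig)⁻¹ * S.H x) := by
      have h2 : S.V x = S.innovCov x Sig - S.H x * Sig * (S.H x)ᵀ := by rw [innovCov]; abel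
      rw [h2, Matrix.sub_mul, mul_nonsing_inv_cancel_left _ _ hu, contraction, Matrix.mul_sub,
        Matrix.mul_one, gain]
      simp only [Matrix.mul_assoc]
    rw [Matrix.mul_assoc _ (S.H x), h1, Matrix.mul_assoc, nonsing_inv_mul_cancel_left _ _ hV,
      Matrix.mul_assoc]
  rw [Matrix.add_mul, Matrix.one_mul, infoMatrix, Matrix.mul_assoc, hC, contraction, gain]
  simp only [Matrix.mul_assoc]
  abel

lemma Model.isUnit_one_add_mul_infoMatrix (x : 𝒳) {Sig : Matrix (Fin ny) (Fin ny) ℝ}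
    (hS : Sig.PosSemidef) : IsUnit (1 + Sig * S.infoMatrix x) :=
  IsUnit.of_mul_eq_one _ (S.one_add_mul_infoMatrix_mul_contraction x hS)

lemma Model.contraction_eq_inv (x : 𝒳) {Sig : Matrix (Fin ny) (Fin ny) ℝ}
    (hS : Sig.PosSemidef) : S.contraction x Sig = (1 + Sig * S.infoMatrix x)⁻¹ :=
  (inv_eq_right_inv (S.one_add_mul_infoMatrix_mul_contraction x hS)).symm

lemma Model.posSemidef_infoMatrix (x : 𝒳) : (S.infoMatrix x).PosSemidef := by
  have h := (S.posDef_V x).inv.posSemidef.conjTranspose_mul_mul_same (S.H x)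
  rwa [conjTranspose_eq_transpose_of_trivial] at h

lemma Model.posDef_inv_add_infoMatrix (x : 𝒳) {Sig : Matrix (Fin ny) (Fin ny) ℝ}
    (hS : Sig.PosDef) : (Sig⁻¹ + S.infoMatrix x).PosDef :=
  hS.inv.add_posSemidef (S.posSemidef_infoMatrix x)

lemma Model.update_eq_inv (x : 𝒳) {Sig : Matrix (Fin ny) (Fin ny) ℝ}
    (hS : Sig.PosDef) : S.update x Sig = (Sig⁻¹ + S.infoMatrix x)⁻¹ := by
  have hu := (Matrix.isUnit_iff_isUnit_det _).1 hS.isUnit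
  refine (inv_eq_right_inv ?_).symm
  have h : Sig⁻¹ + S.infoMatrix x = Sig⁻¹ * (1 + Sig * S.infoMatrix x) := by
    rw [Matrix.mul_add, Matrix.mul_one, nonsing_inv_mul_cancel_left _ _ hu]
  rw [h, update, Matrix.mul_assoc, ← Matrix.mul_assoc (1 + _),
    S.one_add_mul_infoMatrix_mul_contraction x hS.posSemidef, Matrix.one_mul,
    nonsing_inv_mul _ hu]

lemma Model.posSemidef_update (x : 𝒳) {Sig : Matrix (Fin ny) (Fin ny) ℝ}
    (hS : Sig.PosSemidef) : (S.update x Sig).PosSemidef := by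
  rw [S.update_eq_joseph x hS]
  have h1 := hS.mul_mul_conjTranspose_same (S.contraction x Sig)
  have h2 := (S.posDef_V x).posSemidef.mul_mul_conjTranspose_same (S.gain x Sig)
  rw [conjTranspose_eq_transpose_of_trivial] at h1 h2
  exact h1.add h2

lemma Model.posSemidef_predict {Sig : Matrix (Fin ny) (Fin ny) ℝ}
    (hS : Sig.PosSemidef) : (S.predict Sig).PosSemidef := by
  have h1 := hS.mul_mul_conjTranspose_same S.A
  rw [conjTranspose_eq_transpose_of_trivial] at h1
  exact h1.add S.posSemidef_W

lemma Model.posSemidef_riccati (x : 𝒳) {Sig : Matrix (Fin ny) (Fin ny) ℝ}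
    (hS : Sig.PosSemidef) : (S.riccati x Sig).PosSemidef :=
  S.posSemidef_predict (S.posSemidef_update x hS)

lemma Model.posSemidef_targetCov {Sig : Matrix (Fin ny) (Fin ny) ℝ}
    (hS : Sig.PosSemidef) (t : ℕ) : (S.targetCov Sig t).PosSemidef := by
  induction t with
  | zero => exact hS
  | succ t ih =>
    rw [targetCov, Function.iterate_succ_apply']
    exact S.posSemidef_predict ih

/-- The covariance of the prediction error along an arbitrary sensor trajectory. -/
noncomputable def Model.covAlong (Sig₀ : Matrix (Fin ny) (Fin ny) ℝ) (ξ : ℕ → 𝒳) :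
    ℕ → Matrix (Fin ny) (Fin ny) ℝ
  | 0 => Sig₀
  | t + 1 => S.riccati (ξ t) (covAlong Sig₀ ξ t)

lemma Model.posSemidef_covAlong {Sig₀ : Matrix (Fin ny) (Fin ny) ℝ} (hS : Sig₀.PosSemidef)
    (ξ : ℕ → 𝒳) (t : ℕ) : (S.covAlong Sig₀ ξ t).PosSemidef := by
  induction t with
  | zero => exact hS
  | succ t ih => exact S.posSemidef_riccati _ ih

lemma dotProduct_mul_mul_transpose_mulVec {n k : ℕ} (B : Matrix (Fin k) (Fin n) ℝ)
    (Q : Matrix (Fin n) (Fin n) ℝ) (x y : Fin k → ℝ) :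
    x ⬝ᵥ (B * Q * Bᵀ) *ᵥ y = (Bᵀ *ᵥ x) ⬝ᵥ Q *ᵥ (Bᵀ *ᵥ y) := by
  rw [← mulVec_mulVec, ← mulVec_mulVec, dotProduct_mulVec, ← mulVec_transpose]

/-- Both terms of the Joseph form are nonnegative, so both vanish at `a`. Definiteness of `V` gives
`Kᵀ a = 0`, hence `Cᵀ a = a`, and the other term is `aᵀ Σ a`. -/
lemma Model.dotProduct_update_eq_zero (x : 𝒳) {Sig : Matrix (Fin ny) (Fin ny) ℝ}
    (hS : Sig.PosSemidef) {a : Fin ny → ℝ} (ha : a ⬝ᵥ S.update x Sig *ᵥ a = 0) :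
    a ⬝ᵥ Sig *ᵥ a = 0 := by
  rw [S.update_eq_joseph x hS, add_mulVec, dotProduct_add, dotProduct_mul_mul_transpose_mulVec,
    dotProduct_mul_mul_transpose_mulVec] at ha
  have h1 := hS.dotProduct_mulVec_nonneg ((S.contraction x Sig)ᵀ *ᵥ a)
  have h2 := (S.posDef_V x).posSemidef.dotProduct_mulVec_nonneg ((S.gain x Sig)ᵀ *ᵥ a)
  simp only [star_trivial] at h1 h2
  have h3 : (S.gain x Sig)ᵀ *ᵥ a = 0 := by
    by_contra hne
    have := (S.posDef_V x).dotProduct_mulVec_pos hne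
    simp only [star_trivial] at this
    linarith
  have h4 : (S.contraction x Sig)ᵀ *ᵥ a = a := by
    rw [contraction, transpose_sub, transpose_one, transpose_mul, sub_mulVec, ← mulVec_mulVec, h3,
      mulVec_zero, sub_zero, one_mulVec]
  rw [h4] at ha h1
  linarith

/-- A direction in which the filter is certain is one in which the target is deterministic. -/
lemma Model.dotProduct_covAlong_eq_zero {Sig₀ : Matrix (Fin ny) (Fin ny) ℝ}
    (hS : Sig₀.PosSemidef) (ξ : ℕ → 𝒳) (t : ℕ) {a : Fin ny → ℝ}
    (ha : a ⬝ᵥ S.covAlong Sig₀ ξ t *ᵥ a = 0) : a ⬝ᵥ S.targetCov Sig₀ t *ᵥ a = 0 := by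
  induction t generalizing a with
  | zero => exact ha
  | succ t ih =>
    have hc := S.posSemidef_covAlong hS ξ t
    rw [covAlong, riccati, predict, add_mulVec, dotProduct_add,
      dotProduct_mul_mul_transpose_mulVec] at ha
    have h1 := (S.posSemidef_update (ξ t) hc).dotProduct_mulVec_nonneg (S.Aᵀ *ᵥ a)
    have h2 := S.posSemidef_W.dotProduct_mulVec_nonneg a
    simp only [star_trivial] at h1 h2
    -- Both summands of `ha` are nonnegative, so each is zero; the induction moves on to the
    -- direction `Aᵀ a`.
    have h3 := ih (S.dotProduct_update_eq_zero (ξ t) hc (a := S.Aᵀ *ᵥ a) (by linarith))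
    rw [targetCov, Function.iterate_succ_apply', predict, add_mulVec, dotProduct_add,
      dotProduct_mul_mul_transpose_mulVec]
    rw [targetCov] at h3
    linarith

/-- Whatever whitens the target leaves a nondegenerate prediction error. -/
lemma Model.posDef_mul_covAlong_mul {Sig₀ : Matrix (Fin ny) (Fin ny) ℝ}
    (hS : Sig₀.PosSemidef) (ξ : ℕ → 𝒳) (t : ℕ) {r : ℕ} {B : Matrix (Fin r) (Fin ny) ℝ}
    (hB : B * S.targetCov Sig₀ t * Bᵀ = 1) : (B * S.covAlong Sig₀ ξ t * Bᵀ).PosDef := by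
  have h1 := (S.posSemidef_covAlong hS ξ t).mul_mul_conjTranspose_same B
  rw [conjTranspose_eq_transpose_of_trivial] at h1
  refine PosDef.of_dotProduct_mulVec_pos h1.1 fun a ha => ?_
  have h2 := h1.dotProduct_mulVec_nonneg a
  refine lt_of_le_of_ne h2 fun h0 => ha ?_
  rw [star_trivial, dotProduct_mul_mul_transpose_mulVec] at h0
  have h3 := S.dotProduct_covAlong_eq_zero hS ξ t h0.symm
  rw [← dotProduct_mul_mul_transpose_mulVec, hB, one_mulVec] at h3
  exact dotProduct_self_eq_zero.1 h3

lemma Model.posDef_covAlong {Sig₀ : Matrix (Fin ny) (Fin ny) ℝ}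
    (hS : Sig₀.PosSemidef) (ξ : ℕ → 𝒳) (t : ℕ) (hT : (S.targetCov Sig₀ t).PosDef) :
    (S.covAlong Sig₀ ξ t).PosDef := by
  have h1 := S.posSemidef_covAlong hS ξ t
  refine PosDef.of_dotProduct_mulVec_pos h1.1 fun a ha => ?_
  refine lt_of_le_of_ne (h1.dotProduct_mulVec_nonneg a) fun h0 => ?_
  have h2 := hT.dotProduct_mulVec_pos ha
  rw [star_trivial] at h0 h2
  exact h2.ne' (S.dotProduct_covAlong_eq_zero hS ξ t h0.symm)

end Riccati

/-! ### Gaussian vectors -/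

section Gaussian

open Matrix Complex
open scoped RealInnerProductSpace MatrixOrder

variable {n k l : ℕ}

@[fun_prop]
lemma continuous_act (B : Matrix (Fin k) (Fin n) ℝ) : Continuous (act B) := by
  unfold act; fun_prop

@[fun_prop]
lemma measurable_act (B : Matrix (Fin k) (Fin n) ℝ) : Measurable (act B) :=
  (continuous_act B).measurable

@[simp]
lemma act_add (B : Matrix (Fin k) (Fin n) ℝ) (x y : Vec n) : act B (x + y) = act B x + act B y := by
  simp [act, mulVec_add]

@[simp]
lemma act_sub (B : Matrix (Fin k) (Fin n) ℝ) (x y : Vec n) : act B (x - y) = act B x - act B y := by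
  simp [act, mulVec_sub]

@[simp]
lemma act_neg (B : Matrix (Fin k) (Fin n) ℝ) (x : Vec n) : act B (-x) = -act B x := by
  simp [act, mulVec_neg]

@[simp]
lemma act_zero (B : Matrix (Fin k) (Fin n) ℝ) : act B 0 = 0 := by simp [act]

@[simp]
lemma one_act (y : Vec n) : act 1 y = y := by simp [act]

lemma act_act (B : Matrix (Fin k) (Fin n) ℝ) (C : Matrix (Fin n) (Fin l) ℝ) (y : Vec l) :
    act B (act C y) = act (B * C) y := by simp [act, mulVec_mulVec]

lemma sub_act (B C : Matrix (Fin k) (Fin n) ℝ) (y : Vec n) :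
    act (B - C) y = act B y - act C y := by simp [act, sub_mulVec]

lemma neg_act (B : Matrix (Fin k) (Fin n) ℝ) (y : Vec n) :
    act (-B) y = - act B y := by simp [act, neg_mulVec]

lemma inner_eq_dotProduct (x y : Vec n) : ⟪x, y⟫ = x.ofLp ⬝ᵥ y.ofLp := by
  rw [EuclideanSpace.inner_eq_star_dotProduct, star_trivial, dotProduct_comm]

lemma inner_act_left (B : Matrix (Fin k) (Fin n) ℝ) (x : Vec n) (y : Vec k) :
    ⟪act B x, y⟫ = ⟪x, act Bᵀ y⟫ := by
  rw [inner_eq_dotProduct, inner_eq_dotProduct]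
  simp only [act]
  rw [mulVec_transpose, dotProduct_comm, dotProduct_mulVec, dotProduct_comm]

variable {Ω : Type*} [MeasurableSpace Ω] {P : Measure Ω}

/-- Joint characteristic function of two independent vectors. -/
lemma integral_cexp_inner_add_inner [IsProbabilityMeasure P] {X : Ω → Vec n} {Y : Ω → Vec k}
    (hX : Measurable X) (hY : Measurable Y) (h : IndepFun X Y P) (a : Vec n) (b : Vec k) :
    ∫ ω, cexp ((⟪X ω, a⟫ + ⟪Y ω, b⟫ : ℝ) * I) ∂P =
      charFun (P.map X) a * charFun (P.map Y) b := by
  rw [charFun_apply, charFun_apply, integral_map hX.aemeasurable (by fun_prop),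
    integral_map hY.aemeasurable (by fun_prop)]
  have := h.integral_fun_comp_mul_comp (f := fun x : Vec n => cexp (⟪x, a⟫ * I))
    (g := fun y : Vec k => cexp (⟪y, b⟫ * I)) hX.aemeasurable hY.aemeasurable
    (by fun_prop) (by fun_prop)
  rw [← this]
  congr with ω
  rw [← Complex.exp_add]
  push_cast
  ring_nf

lemma map_affine_add [IsProbabilityMeasure P] {X : Ω → Vec n} {Y : Ω → Vec k}
    (hX : Measurable X) (hY : Measurable Y) (h : IndepFun X Y P) {m₁ : Vec n} {m₂ : Vec k}
    {S₁ : Matrix (Fin n) (Fin n) ℝ} {S₂ : Matrix (Fin k) (Fin k) ℝ} (hS₁ : S₁.PosSemidef)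
    (hS₂ : S₂.PosSemidef) (lX : P.map X = multivariateGaussian m₁ S₁)
    (lY : P.map Y = multivariateGaussian m₂ S₂) (C : Matrix (Fin l) (Fin n) ℝ)
    (D : Matrix (Fin l) (Fin k) ℝ) :
    P.map (fun ω => act C (X ω) + act D (Y ω)) =
      multivariateGaussian (act C m₁ + act D m₂) (C * S₁ * Cᵀ + D * S₂ * Dᵀ) := by
  have hpsd : (C * S₁ * Cᵀ + D * S₂ * Dᵀ).PosSemidef := by
    have h1 := hS₁.mul_mul_conjTranspose_same C
    have h2 := hS₂.mul_mul_conjTranspose_same D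
    rw [conjTranspose_eq_transpose_of_trivial] at h1 h2
    exact h1.add h2
  have : IsProbabilityMeasure (P.map fun ω => act C (X ω) + act D (Y ω)) :=
    Measure.isProbabilityMeasure_map (by fun_prop)
  refine Measure.ext_of_charFun ?_
  ext t
  rw [charFun_apply, integral_map (by fun_prop) (by fun_prop)]
  simp_rw [inner_add_left, inner_act_left]
  rw [integral_cexp_inner_add_inner hX hY h, lX, lY, charFun_multivariateGaussian hS₁,
    charFun_multivariateGaussian hS₂, charFun_multivariateGaussian hpsd, ← Complex.exp_add,
    add_mulVec, dotProduct_add, dotProduct_mul_mul_transpose_mulVec,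
    dotProduct_mul_mul_transpose_mulVec, inner_add_right, inner_act_left, inner_act_left,
    transpose_transpose, transpose_transpose]
  congr 1
  simp only [act]
  push_cast
  ring

lemma map_affine {X : Ω → Vec n} [IsProbabilityMeasure P]
    (hX : Measurable X) {m : Vec n} {S : Matrix (Fin n) (Fin n) ℝ} (hS : S.PosSemidef)
    (lX : P.map X = multivariateGaussian m S) (C : Matrix (Fin k) (Fin n) ℝ) (b : Vec k) :
    P.map (fun ω => b + act C (X ω)) = multivariateGaussian (b + act C m) (C * S * Cᵀ) := by
  -- The constant `b` is a degenerate Gaussian vector with covariance `0`.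
  have h := map_affine_add (Y := fun _ => b) hX measurable_const (indepFun_const_right X b)
    (m₂ := b) (S₂ := 0) hS PosSemidef.zero lX (by simp [multivariateGaussian]) C 1
  simp only [one_act, Matrix.mul_zero, Matrix.zero_mul, add_zero] at h
  simpa only [add_comm b] using h

/-- Linear images of two independent Gaussian vectors with vanishing cross-covariance are
independent. -/
lemma indepFun_act_add_act [IsProbabilityMeasure P] {X : Ω → Vec n} {Y : Ω → Vec k}
    (hX : Measurable X) (hY : Measurable Y) (h : IndepFun X Y P) {m₁ : Vec n} {m₂ : Vec k}
    {S₁ : Matrix (Fin n) (Fin n) ℝ} {S₂ : Matrix (Fin k) (Fin k) ℝ} (hS₁ : S₁.PosSemidef)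
    (hS₂ : S₂.PosSemidef) (lX : P.map X = multivariateGaussian m₁ S₁)
    (lY : P.map Y = multivariateGaussian m₂ S₂) {p q : ℕ} (C : Matrix (Fin p) (Fin n) ℝ)
    (D : Matrix (Fin p) (Fin k) ℝ) (C' : Matrix (Fin q) (Fin n) ℝ)
    (D' : Matrix (Fin q) (Fin k) ℝ) (hcross : C * S₁ * C'ᵀ + D * S₂ * D'ᵀ = 0) :
    IndepFun (fun ω => act C (X ω) + act D (Y ω)) (fun ω => act C' (X ω) + act D' (Y ω)) P := by
  rw [indepFun_iff_charFun_prod (by fun_prop) (by fun_prop)]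
  intro t
  have key : ∀ {r : ℕ} (M : Matrix (Fin r) (Fin n) ℝ) (N : Matrix (Fin r) (Fin k) ℝ) (s : Vec r),
      charFun (P.map fun ω => act M (X ω) + act N (Y ω)) s =
        charFun (P.map X) (act Mᵀ s) * charFun (P.map Y) (act Nᵀ s) := by
    intro r M N s
    rw [charFun_apply, integral_map (by fun_prop) (by fun_prop)]
    simp_rw [inner_add_left, inner_act_left]
    rw [integral_cexp_inner_add_inner hX hY h]
  rw [key, key, charFun_apply, integral_map (by fun_prop) (by fun_prop)]
  have hrw : ∀ ω, ⟪WithLp.toLp 2 (act C (X ω) + act D (Y ω), act C' (X ω) + act D' (Y ω)), t⟫ =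
      ⟪X ω, act Cᵀ t.ofLp.1 + act C'ᵀ t.ofLp.2⟫ + ⟪Y ω, act Dᵀ t.ofLp.1 + act D'ᵀ t.ofLp.2⟫ := by
    intro ω
    rw [WithLp.prod_inner_apply]
    simp only [inner_add_left, inner_add_right, inner_act_left]
    ring
  simp_rw [hrw]
  rw [integral_cexp_inner_add_inner hX hY h, lX, lY]
  simp only [charFun_multivariateGaussian hS₁, charFun_multivariateGaussian hS₂]
  rw [← Complex.exp_add, ← Complex.exp_add, ← Complex.exp_add, ← Complex.exp_add]
  congr 1
  have hs : ∀ {r : ℕ} {Q : Matrix (Fin r) (Fin r) ℝ}, Q.PosSemidef → ∀ u v : Fin r → ℝ,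
      (u + v) ⬝ᵥ Q *ᵥ (u + v) = u ⬝ᵥ Q *ᵥ u + v ⬝ᵥ Q *ᵥ v + 2 * (u ⬝ᵥ Q *ᵥ v) := by
    intro r Q hQ u v
    have : v ⬝ᵥ Q *ᵥ u = u ⬝ᵥ Q *ᵥ v := by
      rw [dotProduct_mulVec, ← mulVec_transpose, ← conjTranspose_eq_transpose_of_trivial, hQ.1.eq,
        dotProduct_comm]
    rw [mulVec_add, add_dotProduct, dotProduct_add, dotProduct_add, this]
    ring
  -- The exponent of the joint characteristic function differs from the sum of the two marginal
  -- exponents by this cross term only.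
  have hx : (Cᵀ *ᵥ t.ofLp.1.ofLp) ⬝ᵥ S₁ *ᵥ (C'ᵀ *ᵥ t.ofLp.2.ofLp) +
      (Dᵀ *ᵥ t.ofLp.1.ofLp) ⬝ᵥ S₂ *ᵥ (D'ᵀ *ᵥ t.ofLp.2.ofLp) = 0 := by
    have := congrArg (fun M => t.ofLp.1.ofLp ⬝ᵥ M *ᵥ t.ofLp.2.ofLp) hcross
    simp only [add_mulVec, dotProduct_add, zero_mulVec, dotProduct_zero, ← mulVec_mulVec] at this
    rw [dotProduct_mulVec _ C, dotProduct_mulVec _ D, ← mulVec_transpose,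
      ← mulVec_transpose] at this
    exact this
  simp only [act, WithLp.ofLp_add, hs hS₁, hs hS₂, inner_add_left]
  have hx' := congrArg (fun r : ℝ => (r : ℂ)) hx
  push_cast at hx' ⊢
  linear_combination -hx'

lemma memLp_apply_multivariateGaussian (m : Vec n) (S : Matrix (Fin n) (Fin n) ℝ) (i : Fin n) :
    MemLp (fun x : Vec n => x i) 2 (multivariateGaussian m S) :=
  IsGaussian.memLp_dual _ (EuclideanSpace.proj i : Vec n →L[ℝ] ℝ) 2 (by simp)

lemma integrable_mul_apply_multivariateGaussian (m : Vec n) (S : Matrix (Fin n) (Fin n) ℝ)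
    (i j : Fin n) : Integrable (fun x : Vec n => x i * x j) (multivariateGaussian m S) :=
  (memLp_apply_multivariateGaussian m S i).integrable_mul (memLp_apply_multivariateGaussian m S j)

lemma integral_mul_apply_multivariateGaussian {S : Matrix (Fin n) (Fin n) ℝ} (hS : S.PosSemidef)
    (i j : Fin n) : ∫ x : Vec n, x i * x j ∂(multivariateGaussian 0 S) = S i j := by
  have h0 : ∀ i, ∫ x : Vec n, x i ∂(multivariateGaussian 0 S) = 0 := by
    intro i
    have := ContinuousLinearMap.integral_comp_id_comm (μ := multivariateGaussian 0 S)
      IsGaussian.integrable_id (EuclideanSpace.proj i : Vec n →L[ℝ] ℝ)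
    simpa using this
  have h := covariance_eval_multivariateGaussian (μ := 0) hS i j
  rw [covariance, h0, h0] at h
  simpa using h

lemma dotProduct_mulVec_eq_sum (Q : Matrix (Fin n) (Fin n) ℝ) (x : Fin n → ℝ) :
    x ⬝ᵥ Q *ᵥ x = ∑ i, ∑ j, Q i j * (x i * x j) := by
  simp only [dotProduct, mulVec, Finset.mul_sum]
  exact Finset.sum_congr rfl fun i _ => Finset.sum_congr rfl fun j _ => by ring

lemma integrable_quadratic (m : Vec n) (S Q : Matrix (Fin n) (Fin n) ℝ) :
    Integrable (fun x : Vec n => x.ofLp ⬝ᵥ Q *ᵥ x.ofLp) (multivariateGaussian m S) := by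
  simp_rw [dotProduct_mulVec_eq_sum]
  exact integrable_finsetSum _ fun i _ => integrable_finsetSum _ fun j _ =>
    (integrable_mul_apply_multivariateGaussian m S i j).const_mul _

lemma integral_quadratic {S : Matrix (Fin n) (Fin n) ℝ} (hS : S.PosSemidef)
    (Q : Matrix (Fin n) (Fin n) ℝ) :
    ∫ x : Vec n, x.ofLp ⬝ᵥ Q *ᵥ x.ofLp ∂(multivariateGaussian 0 S) = (Q * S).trace := by
  simp_rw [dotProduct_mulVec_eq_sum]
  have hi := fun i j => (integrable_mul_apply_multivariateGaussian (0 : Vec n) S i j).const_mul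
    (Q i j)
  rw [integral_finsetSum _ fun i _ => integrable_finsetSum _ fun j _ => hi i j]
  simp_rw [integral_finsetSum Finset.univ fun j _ => hi _ j, integral_const_mul,
    integral_mul_apply_multivariateGaussian hS, trace, diag, Matrix.mul_apply]
  refine Finset.sum_congr rfl fun i _ => Finset.sum_congr rfl fun j _ => ?_
  have := hS.1.apply i j
  rw [star_trivial] at this
  rw [this]

lemma integral_quadratic_inv {S : Matrix (Fin n) (Fin n) ℝ} (hS : S.PosDef) :
    ∫ x : Vec n, x.ofLp ⬝ᵥ S⁻¹ *ᵥ x.ofLp ∂(multivariateGaussian 0 S) = n := by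
  rw [integral_quadratic hS.posSemidef,
    nonsing_inv_mul _ ((Matrix.isUnit_iff_isUnit_det _).1 hS.isUnit)]
  simp

/-- The logarithm of the Lebesgue density of the standard Gaussian. -/
noncomputable def logPdf (x : Vec n) : ℝ := -(n / 2 : ℝ) * Real.log (2 * Real.pi) - ‖x‖ ^ 2 / 2

@[fun_prop]
lemma continuous_logPdf : Continuous (logPdf (n := n)) := by unfold logPdf; fun_prop

/-- Two finite measures with the same characteristic function agree; on the density side it is the
Gaussian Fourier integral. -/
lemma stdGaussian_eq_withDensity :
    stdGaussian (Vec n) = volume.withDensity fun x => ENNReal.ofReal (Real.exp (logPdf x)) := by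
  have hexp : ∀ x : Vec n, Real.exp (logPdf x) =
      (2 * Real.pi) ^ (-(n / 2 : ℝ)) * Real.exp (-(1 / 2) * ‖x‖ ^ 2) := by
    intro x
    rw [logPdf, sub_eq_add_neg, Real.exp_add, Real.rpow_def_of_pos (by positivity)]
    ring_nf
  have hint : Integrable (fun x : Vec n => Real.exp (logPdf x)) := by
    simp_rw [hexp]
    refine Integrable.const_mul ?_ _
    have := GaussianFourier.integrable_cexp_neg_mul_sq_norm_add (V := Vec n) (b := 1 / 2)
      (by norm_num) 0 0
    simpa [Complex.norm_exp, ← Complex.ofReal_pow] using this.norm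
  have : IsFiniteMeasure
      ((volume : Measure (Vec n)).withDensity fun x => ENNReal.ofReal (Real.exp (logPdf x))) :=
    isFiniteMeasure_withDensity_ofReal hint.2
  refine Measure.ext_of_charFun ?_
  ext t
  rw [charFun_stdGaussian, charFun_apply,
    integral_withDensity_eq_integral_toReal_smul (by fun_prop) (by simp)]
  have hf := GaussianFourier.integral_cexp_neg_mul_sq_norm_add (V := Vec n) (b := 1 / 2)
    (by norm_num) I t
  simp_rw [ENNReal.toReal_ofReal (Real.exp_pos _).le, hexp]
  have hrw : ∀ x : Vec n, ((2 * Real.pi) ^ (-(n / 2 : ℝ)) * Real.exp (-(1 / 2) * ‖x‖ ^ 2)) •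
      cexp (⟪x, t⟫ * I) = (((2 * Real.pi) ^ (-(n / 2 : ℝ)) : ℝ) : ℂ) *
        cexp (-(1 / 2) * ‖x‖ ^ 2 + I * ⟪t, x⟫) := by
    intro x
    rw [Complex.exp_add, Complex.real_smul, real_inner_comm]
    push_cast
    ring_nf
  simp_rw [hrw]
  rw [integral_const_mul, hf]
  have h2 : ((2 * Real.pi : ℝ) : ℂ) ^ ((n / 2 : ℝ) : ℂ) = ((2 * Real.pi) ^ ((n / 2 : ℝ)) : ℝ) := by
    rw [Complex.ofReal_cpow (by positivity)]
  have h3 : (Real.pi / (1 / 2) : ℂ) ^ (Module.finrank ℝ (Vec n) / 2 : ℂ) =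
      ((2 * Real.pi) ^ ((n / 2 : ℝ)) : ℝ) := by
    rw [← h2, finrank_euclideanSpace_fin]
    push_cast
    congr 1
    ring
  rw [h3, ← mul_assoc, ← Complex.ofReal_mul, ← Real.rpow_add (by positivity)]
  simp
  ring_nf

end Gaussian

/-! ### Densities of Gaussian laws and whitening of covariances -/

section Density

open Matrix
open scoped RealInnerProductSpace MatrixOrder

variable {n : ℕ}

/-- The logarithm of the density of `N(b, S)` with respect to the standard Gaussian. -/
noncomputable def logRatio (S : Matrix (Fin n) (Fin n) ℝ) (b y : Vec n) : ℝ :=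
  -(Real.log S.det) / 2 - ((y - b).ofLp ⬝ᵥ S⁻¹ *ᵥ (y - b).ofLp) / 2 + ‖y‖ ^ 2 / 2

@[fun_prop]
lemma measurable_logRatio {α : Type*} [MeasurableSpace α] (S : Matrix (Fin n) (Fin n) ℝ)
    {f g : α → Vec n} (hf : Measurable f) (hg : Measurable g) :
    Measurable fun a => logRatio S (f a) (g a) := by
  have h : Continuous fun x : Vec n => x.ofLp ⬝ᵥ S⁻¹ *ᵥ x.ofLp := by fun_prop
  unfold logRatio
  exact (measurable_const.sub ((h.measurable.comp (hg.sub hf)).div_const 2)).add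
    ((hg.norm.pow_const 2).div_const 2)

lemma lintegral_comp_affine {A : Matrix (Fin n) (Fin n) ℝ} (hA : A.det ≠ 0) (b : Vec n)
    {h : Vec n → ℝ≥0∞} (hh : Measurable h) :
    ∫⁻ x, h (b + act A x) = ENNReal.ofReal |A.det⁻¹| * ∫⁻ y, h y := by
  have hmap := Measure.map_linearMap_addHaar_eq_smul_addHaar (volume : Measure (Vec n))
    (f := toLpLin 2 2 A) (by rwa [LinearMap.det_toLpLin])
  rw [LinearMap.det_toLpLin] at hmap
  have : ∫⁻ x, h (b + act A x) = ∫⁻ y, h (b + y) ∂(volume.map (toLpLin 2 2 A)) := by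
    exact (lintegral_map (f := fun y => h (b + y)) (g := act A) (by fun_prop)
      (measurable_act A)).symm
  rw [this, hmap, lintegral_smul_measure, lintegral_add_left_eq_self]
  rfl

/-- `N(b, S)` is the image of the standard Gaussian under `x ↦ b + √S x`; change variables and
divide by the standard density. The reference is the standard Gaussian because that is the law of
the whitened target. -/
lemma lintegral_multivariateGaussian {S : Matrix (Fin n) (Fin n) ℝ} (hS : S.PosDef) (b : Vec n)
    {g : Vec n → ℝ≥0∞} (hg : Measurable g) :
    ∫⁻ y, g y ∂(multivariateGaussian b S) =
      ∫⁻ y, ENNReal.ofReal (Real.exp (logRatio S b y)) * g y ∂(stdGaussian (Vec n)) := by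
  set A := CFC.sqrt S with hAdef
  have hAA : A * A = S := CFC.sqrt_mul_sqrt_self S hS.posSemidef.nonneg
  have hdet : A.det * A.det = S.det := by rw [← det_mul, hAA]
  have hA0 : A.det ≠ 0 := fun h => hS.det_pos.ne' (by rw [← hdet, h, zero_mul])
  have hAT : Aᵀ = A := by
    have : A.PosSemidef := (CFC.sqrt_nonneg S).posSemidef
    have := this.1.eq
    rwa [conjTranspose_eq_transpose_of_trivial] at this
  have hAu : IsUnit A.det := isUnit_iff_ne_zero.2 hA0
  have hnorm : ∀ y : Vec n, ‖act A⁻¹ y‖ ^ 2 = y.ofLp ⬝ᵥ S⁻¹ *ᵥ y.ofLp := by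
    intro y
    rw [← real_inner_self_eq_norm_sq, inner_act_left, act_act, inner_eq_dotProduct,
      transpose_nonsing_inv, hAT, ← Matrix.mul_inv_rev, hAA]
    rfl
  have hmul : ∀ x, act A⁻¹ (act A x) = x := by
    intro x
    rw [act_act, nonsing_inv_mul _ hAu, one_act]
  have hG : multivariateGaussian b S = (stdGaussian (Vec n)).map (fun x => b + act A x) := rfl
  rw [hG, lintegral_map hg (by fun_prop), stdGaussian_eq_withDensity,
    lintegral_withDensity_eq_lintegral_mul _ (by fun_prop) (by fun_prop),
    lintegral_withDensity_eq_lintegral_mul _ (by fun_prop) (by fun_prop)]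
  -- The integrand becomes a function of `b + A x`, ready for the affine change of variables.
  have h1 : ∀ x : Vec n, ((fun x => ENNReal.ofReal (Real.exp (logPdf x))) *
      (fun x => g (b + act A x)) : Vec n → ℝ≥0∞) x = (fun y => ENNReal.ofReal (Real.exp (logPdf (act A⁻¹ (y - b)))) *
        g y) (b + act A x) := by
    intro x
    simp [hmul]
  simp_rw [h1]
  rw [lintegral_comp_affine hA0 b (h := fun y => ENNReal.ofReal
    (Real.exp (logPdf (act A⁻¹ (y - b)))) * g y) (by fun_prop),
    ← lintegral_const_mul _ (by fun_prop)]
  refine lintegral_congr fun y => ?_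
  simp only [Pi.mul_apply]
  rw [← mul_assoc, ← mul_assoc, ← ENNReal.ofReal_mul (abs_nonneg _),
    ← ENNReal.ofReal_mul (Real.exp_pos _).le]
  congr 2
  -- The Jacobian supplies the `log det` term, because `(det √S)² = det S`.
  have hlog : |A.det⁻¹| = Real.exp (-(Real.log S.det) / 2) := by
    rw [← hdet, Real.log_mul hA0 hA0, ← Real.exp_log (abs_pos.2 (inv_ne_zero hA0)), Real.log_abs,
      Real.log_inv]
    ring_nf
  rw [hlog, ← Real.exp_add, ← Real.exp_add, logRatio, logPdf, logPdf, hnorm]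
  ring_nf

/-- Factor a covariance matrix as `L Lᵀ` with `L` having a left inverse. -/
lemma exists_whitening {S : Matrix (Fin n) (Fin n) ℝ} (hS : S.PosSemidef) :
    ∃ (r : ℕ) (L : Matrix (Fin n) (Fin r) ℝ) (B : Matrix (Fin r) (Fin n) ℝ),
      L * Lᵀ = S ∧ B * L = 1 := by
  classical
  let U : Matrix (Fin n) (Fin n) ℝ := hS.1.eigenvectorUnitary
  let ev := hS.1.eigenvalues
  have hUU : Uᵀ * U = 1 := by
    have := Matrix.UnitaryGroup.star_mul_self hS.1.eigenvectorUnitary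
    rwa [star_eq_conjTranspose, conjTranspose_eq_transpose_of_trivial] at this
  have hspec : S = U * diagonal ev * Uᵀ := by
    have := hS.1.spectral_theorem
    rw [Unitary.conjStarAlgAut_apply, star_eq_conjTranspose,
      conjTranspose_eq_transpose_of_trivial] at this
    exact this
  let ι := {i : Fin n // ev i ≠ 0}
  let e : Fin (Fintype.card ι) ≃ ι := (Fintype.equivFin ι).symm
  have hpos : ∀ i : ι, 0 < ev i := fun i => lt_of_le_of_ne (hS.eigenvalues_nonneg _) i.2.symm
  -- Only the nonzero eigenvalues are kept, so `r` is the rank of `S`. The columns of `L` are `√λ u`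
  -- and the rows of `B` are `u / √λ`, for unit eigenvectors `u`.
  refine ⟨Fintype.card ι, of fun i j => U i (e j) * √(ev (e j)),
    of fun j i => U i (e j) / √(ev (e j)), ?_, ?_⟩
  · ext i k
    rw [hspec, Matrix.mul_apply, Matrix.mul_apply]
    simp only [of_apply, transpose_apply, mul_diagonal]
    rw [e.sum_comp fun j : ι => U i j * √(ev j) * (U k j * √(ev j))]
    rw [← Finset.sum_subtype (Finset.univ.filter fun j => ev j ≠ 0) (by simp)
      fun j => U i j * √(ev j) * (U k j * √(ev j)), Finset.sum_filter_of_ne]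
    · refine Finset.sum_congr rfl fun j _ => ?_
      have := Real.mul_self_sqrt (hS.eigenvalues_nonneg j)
      linear_combination U i j * U k j * this
    · intro j _ hj h0
      simp [h0] at hj
  · ext j k
    rw [Matrix.mul_apply]
    simp only [of_apply]
    have h1 := congrFun (congrFun hUU (e j)) (e k)
    rw [Matrix.mul_apply] at h1
    simp only [transpose_apply, one_apply, Subtype.val_inj, e.injective.eq_iff] at h1
    rw [one_apply]
    have h2 : ∀ i, U i (e j) / √(ev (e j)) * (U i (e k) * √(ev (e k))) =
        U i (e j) * U i (e k) * (√(ev (e k)) / √(ev (e j))) := fun i => by ring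
    simp_rw [h2]
    rw [← Finset.sum_mul, h1]
    split_ifs with h
    · rw [h, div_self (Real.sqrt_pos.2 (hpos _)).ne', one_mul]
    · rw [zero_mul]

end Density

/-! ### Chain rule for mutual information -/

section Information

open InformationTheory

/-- Data processing, applied to `e` and to its inverse. -/
lemma klDiv_map_measurableEquiv {α β : Type*} [MeasurableSpace α] [MeasurableSpace β]
    (μ ν : Measure α) [IsFiniteMeasure μ] [IsFiniteMeasure ν] (e : α ≃ᵐ β) :
    klDiv (μ.map e) (ν.map e) = klDiv μ ν := by
  refine le_antisymm (klDiv_map_le _ _ e.measurable) ?_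
  have h := klDiv_map_le (μ.map e) (ν.map e) e.symm.measurable
  simpa [Measure.map_map e.symm.measurable e.measurable] using h

/-- The law under which `(X, Z)` is unchanged and `Y` is independent of it. -/
noncomputable def decoupledLaw {Ω α β γ : Type*} [MeasurableSpace Ω] [MeasurableSpace α]
    [MeasurableSpace β] [MeasurableSpace γ] (P : Measure Ω) (Y : Ω → β) (Z : Ω → γ) (X : Ω → α) :
    Measure (α × (β × γ)) :=
  ((P.map fun ω => (X ω, Z ω)).prod (P.map Y)).map fun p => (p.1.1, (p.2, p.1.2))

section

variable {Ω α β γ : Type*} [MeasurableSpace Ω] [MeasurableSpace α]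
  [MeasurableSpace β] [MeasurableSpace γ] {P : Measure Ω} [IsProbabilityMeasure P]
  {Y : Ω → β} {Z : Ω → γ} {X : Ω → α}

lemma isProbabilityMeasure_decoupledLaw (hY : Measurable Y) (hZ : Measurable Z)
    (hX : Measurable X) : IsProbabilityMeasure (decoupledLaw P Y Z X) := by
  have : IsProbabilityMeasure (P.map fun ω => (X ω, Z ω)) :=
    Measure.isProbabilityMeasure_map (by fun_prop)
  have : IsProbabilityMeasure (P.map Y) := Measure.isProbabilityMeasure_map (by fun_prop)
  exact Measure.isProbabilityMeasure_map (by fun_prop)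

lemma lintegral_decoupledLaw (hY : Measurable Y) (hZ : Measurable Z)
    (hX : Measurable X) {f : α × (β × γ) → ℝ≥0∞} (hf : Measurable f) :
    ∫⁻ p, f p ∂(decoupledLaw P Y Z X) = ∫⁻ ω, ∫⁻ y, f (X ω, (y, Z ω)) ∂(P.map Y) ∂P := by
  have : IsProbabilityMeasure (P.map Y) := Measure.isProbabilityMeasure_map (by fun_prop)
  rw [decoupledLaw, lintegral_map hf (by fun_prop), lintegral_prod _ (by fun_prop),
    lintegral_map _ (by fun_prop)]
  exact Measurable.lintegral_prod_right'
    (f := fun q : (α × γ) × β => f (q.1.1, (q.2, q.1.2))) (by fun_prop)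

/-- Drawing the two coordinates one after the other exposes the form to which the chain rule for
`compProd` applies. -/
lemma compProd_prod_eq_map_prodAssoc (μ : Measure α) [IsProbabilityMeasure μ] (κ : Kernel α β)
    [IsMarkovKernel κ] (η : Kernel α γ) [IsMarkovKernel η] :
    μ.compProd (κ.prod η) =
      ((μ.compProd κ).compProd (η.prodMkRight β)).map MeasurableEquiv.prodAssoc := by
  refine Measure.ext_of_lintegral _ fun f hf => ?_
  rw [lintegral_map hf (MeasurableEquiv.measurable _), Measure.lintegral_compProd hf,
    Measure.lintegral_compProd (by fun_prop)]
  rw [Measure.lintegral_compProd]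
  · refine lintegral_congr fun x => ?_
    rw [Kernel.lintegral_prod _ _ _ (by fun_prop)]
    rfl
  · exact Measurable.lintegral_kernel_prod_right' (κ := η.prodMkRight β)
      (f := fun q : (α × β) × γ => f (MeasurableEquiv.prodAssoc q)) (by fun_prop)

variable [StandardBorelSpace γ] [Nonempty γ]

lemma prod_compProd_eq_decoupledLaw (hY : Measurable Y) (hZ : Measurable Z)
    (hX : Measurable X) :
    (((P.map X).prod (P.map Y)).compProd ((condDistrib Z X P).prodMkRight β)).map
      MeasurableEquiv.prodAssoc = decoupledLaw P Y Z X := by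
  have : IsProbabilityMeasure (P.map X) := Measure.isProbabilityMeasure_map (by fun_prop)
  have : IsProbabilityMeasure (P.map Y) := Measure.isProbabilityMeasure_map (by fun_prop)
  refine Measure.ext_of_lintegral _ fun f hf => ?_
  rw [lintegral_decoupledLaw hY hZ hX hf, lintegral_map hf (MeasurableEquiv.measurable _),
    Measure.lintegral_compProd (by fun_prop), lintegral_prod_symm']
  · have hm : Measurable fun q : α × γ => ∫⁻ y, f (q.1, (y, q.2)) ∂(P.map Y) :=
      Measurable.lintegral_prod_right' (f := fun q : (α × γ) × β => f (q.1.1, (q.2, q.1.2)))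
        (by fun_prop)
    rw [← lintegral_map (g := fun ω => (X ω, Z ω)) hm (by fun_prop),
      ← compProd_map_condDistrib hZ.aemeasurable, Measure.lintegral_compProd hm]
    rw [lintegral_lintegral_swap]
    · refine lintegral_congr fun x => ?_
      rw [lintegral_lintegral_swap]
      · rfl
      · exact Measurable.aemeasurable
          (by fun_prop : Measurable fun q : γ × β => f (x, (q.2, q.1)))
    · refine Measurable.aemeasurable ?_
      exact (Measurable.lintegral_kernel_prod_right' (κ := (condDistrib Z X P).prodMkRight β)
        (f := fun q : (α × β) × γ => f (MeasurableEquiv.prodAssoc q)) (by fun_prop)).comp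
          measurable_swap
  · exact Measurable.lintegral_kernel_prod_right' (κ := (condDistrib Z X P).prodMkRight β)
      (f := fun q : (α × β) × γ => f (MeasurableEquiv.prodAssoc q)) (by fun_prop)

variable [StandardBorelSpace β] [Nonempty β]

/-- Chain rule `I(Y; X, Z) = I(Y; X) + I(Y; Z ∣ X)`. The decoupled law and the conditionally
independent law both draw `Z` from `X` alone; they differ only in the law of `(X, Y)`, which
contributes the first summand. -/
lemma klDiv_decoupledLaw (hY : Measurable Y) (hZ : Measurable Z) (hX : Measurable X) :
    klDiv (P.map fun ω => (X ω, (Y ω, Z ω))) (decoupledLaw P Y Z X) =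
      klDiv (P.map fun ω => (X ω, Y ω)) ((P.map X).prod (P.map Y)) + condMutualInfo P Y Z X := by
  have : IsProbabilityMeasure (P.map X) := Measure.isProbabilityMeasure_map (by fun_prop)
  have : IsProbabilityMeasure (P.map Y) := Measure.isProbabilityMeasure_map (by fun_prop)
  have : IsProbabilityMeasure (P.map fun ω => (X ω, Y ω)) :=
    Measure.isProbabilityMeasure_map (by fun_prop)
  have h : (P.map fun ω => (X ω, (Y ω, Z ω))) =
      ((P.map fun ω => (X ω, Y ω)).compProd (condDistrib Z (fun ω => (X ω, Y ω)) P)).map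
        MeasurableEquiv.prodAssoc := by
    rw [compProd_map_condDistrib hZ.aemeasurable,
      Measure.map_map (MeasurableEquiv.measurable _) (by fun_prop)]
    rfl
  rw [condMutualInfo, compProd_prod_eq_map_prodAssoc, compProd_map_condDistrib hY.aemeasurable, h,
    ← prod_compProd_eq_decoupledLaw hY hZ hX, klDiv_map_measurableEquiv,
    klDiv_map_measurableEquiv, klDiv_compProd_eq_add]

lemma condMutualInfo_le_klDiv (hY : Measurable Y) (hZ : Measurable Z) (hX : Measurable X) :
    condMutualInfo P Y Z X ≤
      klDiv (P.map fun ω => (X ω, (Y ω, Z ω))) (decoupledLaw P Y Z X) := by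
  rw [klDiv_decoupledLaw hY hZ hX]
  exact le_add_self

lemma condMutualInfo_eq_klDiv (hY : Measurable Y) (hZ : Measurable Z) (hX : Measurable X)
    (h : IndepFun X Y P) :
    condMutualInfo P Y Z X =
      klDiv (P.map fun ω => (X ω, (Y ω, Z ω))) (decoupledLaw P Y Z X) := by
  rw [klDiv_decoupledLaw hY hZ hX,
    (indepFun_iff_map_prod_eq_prod_map_map hX.aemeasurable hY.aemeasurable).1 h]
  have : IsProbabilityMeasure (P.map X) := Measure.isProbabilityMeasure_map (by fun_prop)
  have : IsProbabilityMeasure (P.map Y) := Measure.isProbabilityMeasure_map (by fun_prop)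
  rw [klDiv_self, zero_add]

end

/-- The log-likelihood ratio is `f` almost everywhere, and both measures have mass one. -/
lemma klDiv_withDensity_exp {α : Type*} [MeasurableSpace α] {μ ν : Measure α}
    [IsProbabilityMeasure μ] [IsProbabilityMeasure ν] {f : α → ℝ} (hf : Measurable f)
    (h : μ = ν.withDensity fun a => ENNReal.ofReal (Real.exp (f a))) (hi : Integrable f μ) :
    klDiv μ ν ≠ ∞ ∧ (klDiv μ ν).toReal = ∫ a, f a ∂μ := by
  have hac : μ ≪ ν := h ▸ withDensity_absolutelyContinuous _ _
  have hllr : llr μ ν =ᵐ[μ] f := by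
    have h1 : μ.rnDeriv ν =ᵐ[ν] fun a => ENNReal.ofReal (Real.exp (f a)) := by
      rw [h]
      exact Measure.rnDeriv_withDensity ν (by fun_prop)
    filter_upwards [hac.ae_le h1] with a ha
    rw [llr, ha, ENNReal.toReal_ofReal (Real.exp_pos _).le, Real.log_exp]
  refine ⟨klDiv_ne_top hac (hi.congr hllr.symm), ?_⟩
  rw [toReal_klDiv_of_measure_eq hac (by simp), integral_congr_ae hllr]

end Information

/-! ### Integration over the fibres of a map with finite range -/

section FiniteRange

lemma integrable_of_fibers {Ω α : Type*} [MeasurableSpace Ω] {P : Measure Ω} {X : Ω → α}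
    (hfin : (Set.range X).Finite) {f : Ω → ℝ}
    (hf : ∀ x, IntegrableOn f (X ⁻¹' {x}) P) : Integrable f P := by
  rw [← integrableOn_univ]
  have : (Set.univ : Set Ω) = ⋃ x ∈ hfin.toFinset, X ⁻¹' {x} := by
    ext ω
    simp
  rw [this, integrableOn_finset_iUnion]
  exact fun x _ => hf x

variable {Ω α : Type*} [MeasurableSpace Ω] [MeasurableSpace α] [MeasurableSingletonClass α]
  {P : Measure Ω} {X : Ω → α}

lemma lintegral_eq_sum_fibers (hX : Measurable X) (hfin : (Set.range X).Finite) (f : Ω → ℝ≥0∞) :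
    ∫⁻ ω, f ω ∂P = ∑ x ∈ hfin.toFinset, ∫⁻ ω in X ⁻¹' {x}, f ω ∂P := by
  rw [← lintegral_biUnion_finset]
  · rw [← setLIntegral_univ]
    congr 2
    ext ω
    simp
  · intro x _ y _ hxy
    exact Disjoint.preimage _ (by simpa using hxy)
  · exact fun x _ => hX (measurableSet_singleton x)

lemma integral_eq_sum_fibers (hX : Measurable X) (hfin : (Set.range X).Finite) {f : Ω → ℝ}
    (hf : ∀ x, IntegrableOn f (X ⁻¹' {x}) P) :
    ∫ ω, f ω ∂P = ∑ x ∈ hfin.toFinset, ∫ ω in X ⁻¹' {x}, f ω ∂P := by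
  rw [← integral_biUnion_finset]
  · rw [← setIntegral_univ]
    congr 2
    ext ω
    simp
  · exact fun x _ => hX (measurableSet_singleton x)
  · intro x _ y _ hxy
    exact Disjoint.preimage _ (by simpa using hxy)
  · exact fun x _ => hf x

lemma integrable_comp_of_finite_range [IsFiniteMeasure P] (hX : Measurable X)
    (hfin : (Set.range X).Finite) (g : α → ℝ) : Integrable (fun ω => g (X ω)) P :=
  integrable_of_fibers (X := X) hfin fun x =>
    (integrableOn_const (C := g x) (measure_ne_top _ _)).congr_fun
      (fun ω hω => by rw [show X ω = x from hω]) (hX (measurableSet_singleton x))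

end FiniteRange

/-! ### Mutual information of a Gaussian channel with a random mode -/

section GaussianChannel

open InformationTheory Matrix

variable {Ω α γ : Type*} [MeasurableSpace Ω] [MeasurableSpace α] [MeasurableSingletonClass α]
  [MeasurableSpace γ] {P : Measure Ω} [IsProbabilityMeasure P]
  {n : ℕ} {Y : Ω → Vec n} {Z : Ω → γ} {X : Ω → α}

/-- On each event `X = x`, the error `Y - pred x Z` is a centred Gaussian vector with covariance
`cov x`, independent of `Z`. -/
structure IsGaussianChannel (P : Measure Ω) (Y : Ω → Vec n) (Z : Ω → γ) (X : Ω → α)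
    (pred : α → γ → Vec n) (cov : α → Matrix (Fin n) (Fin n) ℝ) : Prop where
  measurable_pred : ∀ x, Measurable (pred x)
  posSemidef_cov : ∀ x, (cov x).PosSemidef
  lintegral_fiber : ∀ x (g : γ × Vec n → ℝ≥0∞), Measurable g →
    ∫⁻ ω in X ⁻¹' {x}, g (Z ω, Y ω - pred x (Z ω)) ∂P =
      ∫⁻ ω in X ⁻¹' {x}, ∫⁻ e, g (Z ω, e) ∂(multivariateGaussian 0 (cov x)) ∂P

variable {pred : α → γ → Vec n} {cov : α → Matrix (Fin n) (Fin n) ℝ} {m : Vec n}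
  {S : Matrix (Fin n) (Fin n) ℝ} {r : ℕ} {L : Matrix (Fin n) (Fin r) ℝ}
  {B : Matrix (Fin r) (Fin n) ℝ}

/-- Logarithm of the density of the law of `(X, (Y, Z))` with respect to its decoupled law. -/
noncomputable def channelLogDensity (F : Finset α) (pred : α → γ → Vec n)
    (cov : α → Matrix (Fin n) (Fin n) ℝ) (m : Vec n) (B : Matrix (Fin r) (Fin n) ℝ)
    (p : α × (Vec n × γ)) : ℝ :=
  open Classical in
  ∑ x ∈ F, if p.1 = x then
    logRatio (B * cov x * Bᵀ) (act B (pred x p.2.2 - m)) (act B (p.2.1 - m)) else 0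

omit [MeasurableSpace α] [MeasurableSingletonClass α] [MeasurableSpace γ] in
lemma channelLogDensity_of_mem {F : Finset α} {x : α} (hx : x ∈ F) (y : Vec n) (z : γ) :
    channelLogDensity F pred cov m B (x, (y, z)) =
      logRatio (B * cov x * Bᵀ) (act B (pred x z - m)) (act B (y - m)) := by
  classical
  rw [channelLogDensity, Finset.sum_eq_single x]
  · simp
  · intro b _ hb
    simp [hb.symm]
  · exact fun h => absurd hx h

/-- The finite sum of terms supported on single values of `X` avoids any measurability of `pred` and
`cov` in `x`. -/
lemma measurable_channelLogDensity (F : Finset α) (hpred : ∀ x, Measurable (pred x)) :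
    Measurable (channelLogDensity F pred cov m B) := by
  classical
  unfold channelLogDensity
  refine Finset.measurable_sum _ fun x _ => Measurable.ite ?_ ?_ measurable_const
  · exact measurable_fst (measurableSet_singleton x)
  · have := hpred x
    fun_prop

omit [IsProbabilityMeasure P] in
lemma map_eq_map_whitening
    (lY : P.map Y = multivariateGaussian m S) (hLS : L * Lᵀ = S) :
    P.map Y = (stdGaussian (Vec r)).map fun y => m + act L y := by
  have h := map_affine (X := id) (P := stdGaussian (Vec r)) measurable_id PosSemidef.one
    (by rw [Measure.map_id, multivariateGaussian_zero_one]) L m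
  simp only [id, act_zero, add_zero, Matrix.mul_one, hLS] at h
  rw [h, lY]

omit [IsProbabilityMeasure P] in
-- The law of `Y` is carried by `m + range L`, where `L B` acts as the identity on deviations from
-- `m`. Passing to the whitened coordinates therefore loses nothing, even for singular `S`.
lemma act_whitening_ae (hY : Measurable Y)
    (lY : P.map Y = multivariateGaussian m S) (hLS : L * Lᵀ = S) (hBL : B * L = 1) :
    ∀ᵐ ω ∂P, m + act L (act B (Y ω - m)) = Y ω := by
  have h : ∀ᵐ y ∂(P.map Y), m + act L (act B (y - m)) = y := by
    rw [map_eq_map_whitening lY hLS, ae_map_iff (by fun_prop)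
      (measurableSet_eq_fun (by fun_prop) (by fun_prop))]
    refine Filter.Eventually.of_forall fun y => ?_
    rw [add_sub_cancel_left, act_act B L, hBL, one_act]
  exact ae_of_ae_map hY.aemeasurable h

omit [IsProbabilityMeasure P] in
-- Under `y ↦ B (y - m)` the law of `Y` becomes standard and that of `b + e` becomes `N(B (b - m), B
-- C Bᵀ)`; `logRatio` compares these two nondegenerate laws.
lemma lintegral_density_mul
    (lY : P.map Y = multivariateGaussian m S) (hLS : L * Lᵀ = S) (hBL : B * L = 1)
    {C : Matrix (Fin n) (Fin n) ℝ} (hC : C.PosSemidef) (hBC : (B * C * Bᵀ).PosDef) (b : Vec n)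
    {φ : Vec n → ℝ≥0∞} (hφ : Measurable φ) :
    ∫⁻ y, ENNReal.ofReal (Real.exp (logRatio (B * C * Bᵀ) (act B (b - m)) (act B (y - m)))) * φ y
      ∂(P.map Y) = ∫⁻ e, φ (m + act L (act B (b + e - m))) ∂(multivariateGaussian 0 C) := by
  rw [map_eq_map_whitening lY hLS, lintegral_map (by fun_prop) (by fun_prop)]
  simp_rw [add_sub_cancel_left, act_act B L, hBL, one_act]
  rw [← lintegral_multivariateGaussian hBC (act B (b - m)) (g := fun y => φ (m + act L y))
    (by fun_prop)]
  have h := map_affine (X := id) (P := multivariateGaussian 0 C) measurable_id hC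
    Measure.map_id B (act B (b - m))
  rw [act_zero, add_zero] at h
  rw [← h, lintegral_map (by fun_prop) (by fun_prop)]
  refine lintegral_congr fun e => ?_
  rw [id, ← act_add, sub_add_eq_add_sub]

lemma IsGaussianChannel.map_eq_withDensity (h : IsGaussianChannel P Y Z X pred cov)
    (hY : Measurable Y) (hZ : Measurable Z) (hX : Measurable X) (hfin : (Set.range X).Finite) (lY : P.map Y = multivariateGaussian m S) (hLS : L * Lᵀ = S)
    (hBL : B * L = 1) (hBC : ∀ x, (B * cov x * Bᵀ).PosDef) :
    P.map (fun ω => (X ω, (Y ω, Z ω))) = (decoupledLaw P Y Z X).withDensity fun p =>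
      ENNReal.ofReal (Real.exp (channelLogDensity hfin.toFinset pred cov m B p)) := by
  have hm := measurable_channelLogDensity (cov := cov) (m := m) (B := B) hfin.toFinset
    h.measurable_pred
  have : IsProbabilityMeasure (P.map Y) := Measure.isProbabilityMeasure_map (by fun_prop)
  refine Measure.ext_of_lintegral _ fun φ hφ => ?_
  rw [lintegral_map hφ (by fun_prop), lintegral_withDensity_eq_lintegral_mul _ (by fun_prop) hφ,
    lintegral_decoupledLaw hY hZ hX (by fun_prop), lintegral_eq_sum_fibers hX hfin,
    lintegral_eq_sum_fibers hX hfin]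
  refine Finset.sum_congr rfl fun x hx => ?_
  have hpx := h.measurable_pred x
  have hxm : MeasurableSet (X ⁻¹' {x}) := hX (measurableSet_singleton x)
  -- On the fibre, `Y` is almost surely recovered from its whitened coordinates and is the
  -- prediction plus the error.
  have h1 : ∫⁻ ω in X ⁻¹' {x}, φ (X ω, (Y ω, Z ω)) ∂P = ∫⁻ ω in X ⁻¹' {x},
      (fun q : γ × Vec n => φ (x, (m + act L (act B (pred x q.1 + q.2 - m)), q.1)))
        (Z ω, Y ω - pred x (Z ω)) ∂P := by
    refine lintegral_congr_ae ?_
    filter_upwards [ae_restrict_mem hxm, ae_restrict_of_ae (act_whitening_ae hY lY hLS hBL)]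
      with ω hω hω'
    simp only [add_sub_cancel, hω', show X ω = x from hω]
  rw [h1, h.lintegral_fiber x (fun q => φ (x, (m + act L (act B (pred x q.1 + q.2 - m)), q.1)))
    (by fun_prop)]
  refine setLIntegral_congr_fun hxm fun ω hω => ?_
  simp only [Pi.mul_apply, show X ω = x from hω, channelLogDensity_of_mem hx]
  exact (lintegral_density_mul lY hLS hBL (h.posSemidef_cov x) (hBC x) _
    (φ := fun y => φ (x, (y, Z ω))) (by fun_prop)).symm

omit [MeasurableSpace α] [MeasurableSingletonClass α] [IsProbabilityMeasure P] in
lemma IsGaussianChannel.map_restrict_error (h : IsGaussianChannel P Y Z X pred cov)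
    (hY : Measurable Y) (hZ : Measurable Z) (x : α) :
    (P.restrict (X ⁻¹' {x})).map (fun ω => Y ω - pred x (Z ω)) =
      P (X ⁻¹' {x}) • multivariateGaussian 0 (cov x) := by
  have hpx := h.measurable_pred x
  refine Measure.ext_of_lintegral _ fun φ hφ => ?_
  rw [lintegral_map hφ (by fun_prop), h.lintegral_fiber x (fun q => φ q.2) (by fun_prop),
    lintegral_smul_measure]
  simp [mul_comm]

lemma dotProduct_act (Q : Matrix (Fin r) (Fin r) ℝ) (e : Vec n) :
    (act B e).ofLp ⬝ᵥ Q *ᵥ (act B e).ofLp = e.ofLp ⬝ᵥ (Bᵀ * Q * B) *ᵥ e.ofLp := by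
  have := dotProduct_mul_mul_transpose_mulVec Bᵀ Q e.ofLp e.ofLp
  rw [transpose_transpose] at this
  exact this.symm

omit [MeasurableSpace α] [MeasurableSingletonClass α] in
-- By cyclicity of the trace, `tr (Bᵀ (B C Bᵀ)⁻¹ B C) = tr 1 = r`, whatever the covariance `C`.
lemma IsGaussianChannel.integral_fiber (h : IsGaussianChannel P Y Z X pred cov)
    (hY : Measurable Y) (hZ : Measurable Z) (hBC : ∀ x, (B * cov x * Bᵀ).PosDef) (x : α) :
    IntegrableOn (fun ω => (act B (Y ω - pred x (Z ω))).ofLp ⬝ᵥ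
      (B * cov x * Bᵀ)⁻¹ *ᵥ (act B (Y ω - pred x (Z ω))).ofLp) (X ⁻¹' {x}) P ∧
    ∫ ω in X ⁻¹' {x}, (act B (Y ω - pred x (Z ω))).ofLp ⬝ᵥ
      (B * cov x * Bᵀ)⁻¹ *ᵥ (act B (Y ω - pred x (Z ω))).ofLp ∂P = P.real (X ⁻¹' {x}) * r := by
  have hpx := h.measurable_pred x
  simp_rw [dotProduct_act]
  set Q := Bᵀ * (B * cov x * Bᵀ)⁻¹ * B with hQ
  have hc : Continuous fun e : Vec n => e.ofLp ⬝ᵥ Q *ᵥ e.ofLp := by fun_prop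
  have hmap := h.map_restrict_error hY hZ x
  constructor
  · refine Integrable.comp_measurable (f := fun ω => Y ω - pred x (Z ω))
      (g := fun e : Vec n => e.ofLp ⬝ᵥ Q *ᵥ e.ofLp) ?_ (by fun_prop)
    rw [hmap]
    exact (integrable_quadratic 0 _ Q).smul_measure (measure_ne_top _ _)
  · rw [← integral_map (φ := fun ω => Y ω - pred x (Z ω))
      (f := fun e : Vec n => e.ofLp ⬝ᵥ Q *ᵥ e.ofLp) (by fun_prop) hc.aestronglyMeasurable, hmap,
      integral_smul_measure, integral_quadratic (h.posSemidef_cov x), hQ, smul_eq_mul,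
      Matrix.mul_assoc, Matrix.mul_assoc, trace_mul_comm, Matrix.mul_assoc,
      Matrix.nonsing_inv_mul _ ((Matrix.isUnit_iff_isUnit_det _).1 (hBC x).isUnit)]
    simp [Measure.real]

omit [IsProbabilityMeasure P] in
lemma integral_norm_sq_whitening (hY : Measurable Y)
    (lY : P.map Y = multivariateGaussian m S) (hLS : L * Lᵀ = S) (hBL : B * L = 1) :
    Integrable (fun ω => ‖act B (Y ω - m)‖ ^ 2) P ∧ ∫ ω, ‖act B (Y ω - m)‖ ^ 2 ∂P = r := by
  have hmap : P.map (fun ω => act B (Y ω - m)) = multivariateGaussian 0 1 := by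
    have h2 : (fun ω => act B (Y ω - m)) = (fun y => act B (y - m)) ∘ Y := rfl
    rw [h2, ← Measure.map_map (by fun_prop) hY, map_eq_map_whitening lY hLS,
      Measure.map_map (by fun_prop) (by fun_prop), multivariateGaussian_zero_one]
    have h3 : ((fun y => act B (y - m)) ∘ fun y => m + act L y) = id := by
      ext1 y
      simp only [Function.comp, add_sub_cancel_left, act_act B L, hBL, one_act, id]
    rw [h3, Measure.map_id]
  have hn : ∀ y : Vec r, ‖y‖ ^ 2 = y.ofLp ⬝ᵥ (1 : Matrix (Fin r) (Fin r) ℝ)⁻¹ *ᵥ y.ofLp := by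
    intro y
    rw [inv_one, one_mulVec, ← inner_eq_dotProduct, real_inner_self_eq_norm_sq]
  constructor
  · refine Integrable.comp_measurable (f := fun ω => act B (Y ω - m))
      (g := fun y : Vec r => ‖y‖ ^ 2) ?_ (by fun_prop)
    rw [hmap]
    simp_rw [hn]
    exact integrable_quadratic 0 _ _
  · rw [← integral_map (φ := fun ω => act B (Y ω - m)) (f := fun y : Vec r => ‖y‖ ^ 2)
      (by fun_prop) (by fun_prop), hmap]
    simp_rw [hn]
    exact integral_quadratic_inv PosDef.one

/-- The whitened error, in its own inverse covariance, and the whitened target both have mean square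
`r`. These contributions cancel, and only the `log det` term survives. -/
lemma IsGaussianChannel.integral_logDensity (h : IsGaussianChannel P Y Z X pred cov)
    (hY : Measurable Y) (hZ : Measurable Z) (hX : Measurable X) (hfin : (Set.range X).Finite) (lY : P.map Y = multivariateGaussian m S) (hLS : L * Lᵀ = S)
    (hBL : B * L = 1) (hBC : ∀ x, (B * cov x * Bᵀ).PosDef) :
    Integrable (fun ω => channelLogDensity hfin.toFinset pred cov m B (X ω, (Y ω, Z ω))) P ∧
    ∫ ω, channelLogDensity hfin.toFinset pred cov m B (X ω, (Y ω, Z ω)) ∂P =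
      ∫ ω, -(Real.log (B * cov (X ω) * Bᵀ).det) / 2 ∂P := by
  obtain ⟨hi3, he3⟩ := integral_norm_sq_whitening hY lY hLS hBL
  have hi1 := integrable_comp_of_finite_range (P := P) hX hfin
    fun x => -(Real.log (B * cov x * Bᵀ).det) / 2
  let q : Ω → ℝ := fun ω => (act B (Y ω - pred (X ω) (Z ω))).ofLp ⬝ᵥ
      (B * cov (X ω) * Bᵀ)⁻¹ *ᵥ (act B (Y ω - pred (X ω) (Z ω))).ofLp
  have hqx : ∀ x, Set.EqOn q (fun ω => (act B (Y ω - pred x (Z ω))).ofLp ⬝ᵥ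
      (B * cov x * Bᵀ)⁻¹ *ᵥ (act B (Y ω - pred x (Z ω))).ofLp) (X ⁻¹' {x}) := by
    intro x ω hω
    simp only [q, show X ω = x from hω]
  have hxm : ∀ x, MeasurableSet (X ⁻¹' {x}) := fun x => hX (measurableSet_singleton x)
  have hq := fun x => h.integral_fiber hY hZ hBC x
  have hqi : ∀ x, IntegrableOn q (X ⁻¹' {x}) P := fun x =>
    (hq x).1.congr_fun (hqx x).symm (hxm x)
  have hi2 : Integrable q P := integrable_of_fibers hfin hqi
  have he2 : ∫ ω, q ω ∂P = r := by
    have h1 : ∫ _, (1 : ℝ) ∂P = ∑ x ∈ hfin.toFinset, ∫ _ in X ⁻¹' {x}, (1 : ℝ) ∂P :=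
      integral_eq_sum_fibers hX hfin fun x => integrableOn_const (measure_ne_top _ _)
    rw [integral_eq_sum_fibers hX hfin hqi]
    simp_rw [fun x => setIntegral_congr_fun (μ := P) (hxm x) (hqx x), fun x => (hq x).2]
    rw [← Finset.sum_mul]
    simp only [integral_const, smul_eq_mul, mul_one, probReal_univ, measureReal_restrict_apply_univ] at h1
    rw [← h1, one_mul]
  have heq : ∀ ω, channelLogDensity hfin.toFinset pred cov m B (X ω, (Y ω, Z ω)) =
      -(Real.log (B * cov (X ω) * Bᵀ).det) / 2 - q ω / 2 + ‖act B (Y ω - m)‖ ^ 2 / 2 := by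
    intro ω
    rw [channelLogDensity_of_mem (by simp), logRatio, ← act_sub]
    simp only [q, sub_sub_sub_cancel_right]
  simp_rw [heq]
  refine ⟨(hi1.sub (hi2.div_const 2)).add (hi3.div_const 2), ?_⟩
  have hadd := integral_add (hi1.sub (hi2.div_const 2)) (hi3.div_const 2)
  simp only [Pi.sub_apply] at hadd
  rw [hadd, integral_sub hi1 (hi2.div_const 2), integral_div 2 q,
    integral_div 2 fun ω => ‖act B (Y ω - m)‖ ^ 2, he2, he3]
  ring

lemma IsGaussianChannel.klDiv_decoupledLaw (h : IsGaussianChannel P Y Z X pred cov)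
    (hY : Measurable Y) (hZ : Measurable Z) (hX : Measurable X) (hfin : (Set.range X).Finite) (lY : P.map Y = multivariateGaussian m S) (hLS : L * Lᵀ = S)
    (hBL : B * L = 1) (hBC : ∀ x, (B * cov x * Bᵀ).PosDef) :
    klDiv (P.map fun ω => (X ω, (Y ω, Z ω))) (decoupledLaw P Y Z X) ≠ ∞ ∧
    (klDiv (P.map fun ω => (X ω, (Y ω, Z ω))) (decoupledLaw P Y Z X)).toReal =
      ∫ ω, -(Real.log (B * cov (X ω) * Bᵀ).det) / 2 ∂P := by
  have := isProbabilityMeasure_decoupledLaw (P := P) hY hZ hX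
  have : IsProbabilityMeasure (P.map fun ω => (X ω, (Y ω, Z ω))) :=
    Measure.isProbabilityMeasure_map (by fun_prop)
  have hm := measurable_channelLogDensity (cov := cov) (m := m) (B := B) hfin.toFinset
    h.measurable_pred
  obtain ⟨hi, he⟩ := h.integral_logDensity hY hZ hX hfin lY hLS hBL hBC
  have hXYZ : Measurable fun ω => (X ω, (Y ω, Z ω)) := by fun_prop
  rw [← he, ← integral_map (φ := fun ω => (X ω, (Y ω, Z ω))) hXYZ.aemeasurable
    hm.aestronglyMeasurable]
  exact klDiv_withDensity_exp hm (h.map_eq_withDensity hY hZ hX hfin lY hLS hBL hBC)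
    ((integrable_map_measure hm.aestronglyMeasurable hXYZ.aemeasurable).2 hi)

variable [StandardBorelSpace γ] [Nonempty γ]

/-- The slack is `I(X; Y)`, the information that the choice of trajectory itself reveals about the
target. -/
lemma IsGaussianChannel.condMutualInfo_le (h : IsGaussianChannel P Y Z X pred cov)
    (hY : Measurable Y) (hZ : Measurable Z) (hX : Measurable X) (hfin : (Set.range X).Finite) (lY : P.map Y = multivariateGaussian m S) (hLS : L * Lᵀ = S)
    (hBL : B * L = 1) (hBC : ∀ x, (B * cov x * Bᵀ).PosDef) :
    condMutualInfo P Y Z X ≠ ∞ ∧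
    (condMutualInfo P Y Z X).toReal ≤ ∫ ω, -(Real.log (B * cov (X ω) * Bᵀ).det) / 2 ∂P := by
  obtain ⟨h1, h2⟩ := h.klDiv_decoupledLaw hY hZ hX hfin lY hLS hBL hBC
  have h3 := condMutualInfo_le_klDiv (P := P) hY hZ hX
  exact ⟨ne_top_of_le_ne_top h1 h3, h2 ▸ ENNReal.toReal_mono h1 h3⟩

lemma IsGaussianChannel.condMutualInfo_eq {x : α} (h : IsGaussianChannel P Y Z (fun _ => x) pred cov)
    (hY : Measurable Y) (hZ : Measurable Z) (lY : P.map Y = multivariateGaussian m S) (hLS : L * Lᵀ = S)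
    (hBL : B * L = 1) (hBC : ∀ x, (B * cov x * Bᵀ).PosDef) :
    condMutualInfo P Y Z (fun _ => x) ≠ ∞ ∧
    (condMutualInfo P Y Z (fun _ => x)).toReal = -(Real.log (B * cov x * Bᵀ).det) / 2 := by
  rw [condMutualInfo_eq_klDiv hY hZ measurable_const (indepFun_const_left x Y)]
  have := h.klDiv_decoupledLaw hY hZ measurable_const
    ((Set.finite_singleton x).subset Set.range_const_subset) lY hLS hBL hBC
  simpa using this

end GaussianChannel

/-! ### Regrouping independent variables -/

section Independence

variable {Ω α β γ : Type*} [MeasurableSpace Ω] [mα : MeasurableSpace α]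
  [MeasurableSpace β] [MeasurableSpace γ] {P : Measure Ω}

/-- The hypotheses factor the joint law into three marginals; reassociate the product. -/
lemma indepFun_prodMk_left_of_indepFun_prodMk [IsProbabilityMeasure P] {X : Ω → α} {Y : Ω → β}
    {Z : Ω → γ} (hX : Measurable X) (hY : Measurable Y) (hZ : Measurable Z)
    (h : IndepFun X (fun ω => (Y ω, Z ω)) P) (hYZ : IndepFun Y Z P) :
    IndepFun (fun ω => (X ω, Y ω)) Z P := by
  have hXY : IndepFun X Y P := h.comp (φ := id) measurable_id measurable_fst
  have : IsProbabilityMeasure (P.map X) := Measure.isProbabilityMeasure_map hX.aemeasurable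
  have : IsProbabilityMeasure (P.map Y) := Measure.isProbabilityMeasure_map hY.aemeasurable
  have : IsProbabilityMeasure (P.map Z) := Measure.isProbabilityMeasure_map hZ.aemeasurable
  rw [indepFun_iff_map_prod_eq_prod_map_map (by fun_prop) (by fun_prop)] at *
  rw [hXY]
  have e := congrArg (Measure.map MeasurableEquiv.prodAssoc.symm) h
  rw [hYZ, ← Measure.prodAssoc_prod, Measure.map_map (by fun_prop) (by fun_prop),
    Measure.map_map (by fun_prop) (by fun_prop)] at e
  simpa [Function.comp_def, MeasurableEquiv.prodAssoc] using e

lemma IndepFun.of_measurable_comap {X : Ω → α} {Z : Ω → γ} (h : IndepFun X Z P) {f : Ω → β}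
    (hf : Measurable[mα.comap X] f) : IndepFun f Z P := by
  rw [IndepFun_iff_Indep] at h ⊢
  exact indep_of_indep_of_le_left h hf.comap_le

lemma iIndepFun.indepFun_prefix {β : Type*} [MeasurableSpace β] {f : ℕ → Ω → β}
    (h : iIndepFun f P) (hf : ∀ k, Measurable (f k)) (t : ℕ) :
    IndepFun (fun ω (k : Fin t) => f k ω) (f t) P := by
  have h1 := h.indepFun_finset (Finset.range t) {t} (by simp) hf
  exact h1.comp (φ := fun (g : Finset.range t → β) (k : Fin t) => g ⟨k, by simp⟩)
    (ψ := fun g : ({t} : Finset ℕ) → β => g ⟨t, by simp⟩)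
    (by fun_prop) (by fun_prop)

end Independence

/-! ### The Kalman filter along a fixed trajectory -/

section Kalman

open Matrix

variable {𝒳 𝒰 : Type*} {ny nz : ℕ} {S : Model 𝒳 𝒰 ny nz} {m : Vec ny}
  {Sig₀ : Matrix (Fin ny) (Fin ny) ℝ} {Ω : Type*} [MeasurableSpace Ω] {P : Measure Ω}
  (R : Primitives S m Sig₀ P)

/-- The measurement `z_{k+1}` taken from the sensor state `ξ k`. -/
noncomputable def Primitives.meas (ξ : ℕ → 𝒳) (k : ℕ) (ω : Ω) : Vec nz :=
  act (S.H (ξ k)) (R.target k ω) + R.v k (ξ k) ω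

/-- The Kalman predictor of the target state `y_{t+1}` from `z_{1:t}` along the trajectory `ξ`. -/
noncomputable def Model.predictor (S : Model 𝒳 𝒰 ny nz) (m : Vec ny)
    (Sig₀ : Matrix (Fin ny) (Fin ny) ℝ) (ξ : ℕ → 𝒳) : (t : ℕ) → (Fin t → Vec nz) → Vec ny
  | 0, _ => m
  | t + 1, z => act S.A (predictor S m Sig₀ ξ t (Fin.init z) +
      act (S.gain (ξ t) (S.covAlong Sig₀ ξ t))
        (z (Fin.last t) - act (S.H (ξ t)) (predictor S m Sig₀ ξ t (Fin.init z))))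

lemma Model.measurable_predictor (ξ : ℕ → 𝒳) (t : ℕ) :
    Measurable (S.predictor m Sig₀ ξ t) := by
  induction t with
  | zero => exact measurable_const
  | succ t ih =>
    have h : Measurable fun z : Fin (t + 1) → Vec nz => S.predictor m Sig₀ ξ t (Fin.init z) :=
      ih.comp (measurable_pi_lambda _ fun i => measurable_pi_apply _)
    change Measurable fun z : Fin (t + 1) → Vec nz => act S.A (S.predictor m Sig₀ ξ t (Fin.init z) +
      act (S.gain (ξ t) (S.covAlong Sig₀ ξ t))
        (z (Fin.last t) - act (S.H (ξ t)) (S.predictor m Sig₀ ξ t (Fin.init z))))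
    fun_prop

/-- The error of the Kalman predictor along the trajectory `ξ`. -/
noncomputable def Primitives.error (ξ : ℕ → 𝒳) (t : ℕ) (ω : Ω) : Vec ny :=
  R.target t ω - S.predictor m Sig₀ ξ t fun k => R.meas ξ k ω

/-- Splits a measurement into its prediction and the innovation. Writing `act 1` puts the innovation
in the form used by `indepFun_act_add_act`. -/
lemma Primitives.meas_eq (ξ : ℕ → 𝒳) (t : ℕ) (ω : Ω) :
    R.meas ξ t ω = act (S.H (ξ t)) (S.predictor m Sig₀ ξ t fun k => R.meas ξ k ω) +
      (act (S.H (ξ t)) (R.error ξ t ω) + act 1 (R.v t (ξ t) ω)) := by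
  rw [error, act_sub, meas, one_act]
  abel

/-- The predictor cancels, leaving a linear recursion driven by the fresh noises alone. -/
lemma Primitives.error_succ (ξ : ℕ → 𝒳) (t : ℕ) (ω : Ω) :
    R.error ξ (t + 1) ω = act S.A
      (act (S.contraction (ξ t) (S.covAlong Sig₀ ξ t)) (R.error ξ t ω) +
        act (-S.gain (ξ t) (S.covAlong Sig₀ ξ t)) (R.v t (ξ t) ω)) + act 1 (R.w t ω) := by
  have h : R.error ξ (t + 1) ω = act S.A (R.target t ω) + R.w t ω -
      act S.A ((S.predictor m Sig₀ ξ t fun k => R.meas ξ k ω) +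
        act (S.gain (ξ t) (S.covAlong Sig₀ ξ t)) (R.meas ξ t ω -
          act (S.H (ξ t)) (S.predictor m Sig₀ ξ t fun k => R.meas ξ k ω))) := rfl
  rw [h, R.meas_eq ξ t ω, error]
  simp only [Model.contraction, sub_act, neg_act, one_act, act_add, act_sub, act_neg, ← act_act]
  abel

/-- The randomness that precedes the noises `w t` and `v t`. -/
def Primitives.past (ξ : ℕ → 𝒳) (t : ℕ) (ω : Ω) :
    Vec ny × (Vec nz × ((Fin t → Vec ny) × (Fin t → Vec nz))) :=
  (R.y₁ ω, (R.z₀ ω, (fun k => R.w k ω, fun k => R.v k (ξ k) ω)))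

@[fun_prop]
lemma Primitives.measurable_past (ξ : ℕ → 𝒳) (t : ℕ) : Measurable (R.past ξ t) := by
  have := R.measurable_y₁
  have := R.measurable_z₀
  have := R.measurable_w
  have := R.measurable_v
  unfold past
  fun_prop

lemma Primitives.comap_past_le (ξ : ℕ → 𝒳) (t : ℕ) :
    MeasurableSpace.comap (R.past ξ t) inferInstance ≤
      MeasurableSpace.comap (R.past ξ (t + 1)) inferInstance := by
  have h : R.past ξ t = (fun p : Vec ny × (Vec nz × ((Fin (t + 1) → Vec ny) ×
      (Fin (t + 1) → Vec nz))) => (p.1, (p.2.1, (fun k : Fin t => p.2.2.1 k.castSucc,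
        fun k : Fin t => p.2.2.2 k.castSucc)))) ∘ R.past ξ (t + 1) := rfl
  rw [h, ← MeasurableSpace.comap_comp]
  exact MeasurableSpace.comap_mono (Measurable.comap_le (by fun_prop))

lemma Primitives.measurable_past_succ_w (ξ : ℕ → 𝒳) (t : ℕ) :
    Measurable[MeasurableSpace.comap (R.past ξ (t + 1)) inferInstance] (R.w t) :=
  (by fun_prop : Measurable fun p : Vec ny × (Vec nz × ((Fin (t + 1) → Vec ny) ×
      (Fin (t + 1) → Vec nz))) => p.2.2.1 (Fin.last t)).comp (comap_measurable _)

lemma Primitives.measurable_past_succ_v (ξ : ℕ → 𝒳) (t : ℕ) :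
    Measurable[MeasurableSpace.comap (R.past ξ (t + 1)) inferInstance] (R.v t (ξ t)) :=
  (by fun_prop : Measurable fun p : Vec ny × (Vec nz × ((Fin (t + 1) → Vec ny) ×
      (Fin (t + 1) → Vec nz))) => p.2.2.2 (Fin.last t)).comp (comap_measurable _)

lemma Primitives.measurable_past_target (ξ : ℕ → 𝒳) (t : ℕ) :
    Measurable[MeasurableSpace.comap (R.past ξ t) inferInstance] (R.target t) := by
  induction t with
  | zero => exact measurable_fst.comp (comap_measurable _)
  | succ t ih =>
    exact ((measurable_act S.A).comp (ih.mono (R.comap_past_le ξ t) le_rfl)).add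
      (R.measurable_past_succ_w ξ t)

lemma Primitives.measurable_past_meas (ξ : ℕ → 𝒳) {k t : ℕ} (hk : k < t) :
    Measurable[MeasurableSpace.comap (R.past ξ t) inferInstance] (R.meas ξ k) := by
  induction t with
  | zero => omega
  | succ t ih =>
    rcases Nat.lt_succ_iff_lt_or_eq.1 hk with h | rfl
    · exact (ih h).mono (R.comap_past_le ξ t) le_rfl
    · exact ((measurable_act _).comp
        ((R.measurable_past_target ξ k).mono (R.comap_past_le ξ k) le_rfl)).add
          (R.measurable_past_succ_v ξ k)

/-- The signals `(z₀, z_{1:t})` received along the trajectory `ξ`. -/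
noncomputable def Primitives.signals (ξ : ℕ → 𝒳) (t : ℕ) (ω : Ω) : Vec nz × (Fin t → Vec nz) :=
  (R.z₀ ω, fun k => R.meas ξ k ω)

lemma Primitives.measurable_past_signals (ξ : ℕ → 𝒳) (t : ℕ) :
    Measurable[MeasurableSpace.comap (R.past ξ t) inferInstance] (R.signals ξ t) :=
  Measurable.prodMk ((measurable_fst.comp measurable_snd).comp (comap_measurable _))
    (@measurable_pi_lambda _ _ _ (MeasurableSpace.comap (R.past ξ t) inferInstance) _ _
      fun k => R.measurable_past_meas ξ k.2)

lemma Primitives.measurable_past_error (ξ : ℕ → 𝒳) (t : ℕ) :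
    Measurable[MeasurableSpace.comap (R.past ξ t) inferInstance] (R.error ξ t) :=
  (R.measurable_past_target ξ t).sub ((Model.measurable_predictor ξ t).comp
    (measurable_snd.comp (R.measurable_past_signals ξ t)))

lemma Primitives.measurable_target (t : ℕ) : Measurable (R.target t) := by
  induction t with
  | zero => exact R.measurable_y₁
  | succ t ih =>
    exact ((measurable_act S.A).comp ih).add (R.measurable_w t)

lemma Primitives.measurable_signals (ξ : ℕ → 𝒳) (t : ℕ) : Measurable (R.signals ξ t) :=
  (R.measurable_past_signals ξ t).mono (R.measurable_past ξ t).comap_le le_rfl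

lemma Primitives.measurable_error (ξ : ℕ → 𝒳) (t : ℕ) : Measurable (R.error ξ t) :=
  (R.measurable_past_error ξ t).mono (R.measurable_past ξ t).comap_le le_rfl

variable [IsProbabilityMeasure P]

/-- The earlier measurement noises come first; then `w`, `z₀` and `y₁` are adjoined one at a time,
each independent of everything already collected. -/
lemma Primitives.indepFun_past_v (ξ : ℕ → 𝒳) (t : ℕ) :
    IndepFun (R.past ξ t) (R.v t (ξ t)) P := by
  have := R.measurable_y₁
  have := R.measurable_z₀
  have := R.measurable_w
  have := R.measurable_v
  have h0 : IndepFun (fun ω (k : Fin t) => R.v k (ξ k) ω) (R.v t (ξ t)) P :=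
    iIndepFun.indepFun_prefix (f := fun k => R.v k (ξ k))
      (R.iIndep_v.comp (fun k g => g (ξ k)) fun k => measurable_pi_apply _) (by fun_prop) t
  have h1 : IndepFun (fun ω => (fun (k : Fin t) => R.w k ω, fun (k : Fin t) => R.v k (ξ k) ω))
      (R.v t (ξ t)) P :=
    indepFun_prodMk_left_of_indepFun_prodMk (by fun_prop) (by fun_prop) (by fun_prop)
      (R.indep_w_v.comp (φ := fun (g : ℕ → Vec ny) (k : Fin t) => g k)
        (ψ := fun g : ℕ → 𝒳 → Vec nz => (fun k : Fin t => g k (ξ k), g t (ξ t))) (by fun_prop) (by fun_prop)) h0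
  have h2 := indepFun_prodMk_left_of_indepFun_prodMk (by fun_prop) (by fun_prop) (by fun_prop)
      (R.indep_z₀.comp (φ := id) (ψ := fun g : (ℕ → Vec ny) × (ℕ → 𝒳 → Vec nz) => ((fun k : Fin t => g.1 k,
        fun k : Fin t => g.2 k (ξ k)), g.2 t (ξ t))) (by fun_prop) (by fun_prop)) h1
  exact indepFun_prodMk_left_of_indepFun_prodMk (by fun_prop) (by fun_prop) (by fun_prop)
      (R.indep_y₁.comp (φ := id)
        (ψ := fun g : Vec nz × ((ℕ → Vec ny) × (ℕ → 𝒳 → Vec nz)) => ((g.1, (fun k : Fin t => g.2.1 k,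
        fun k : Fin t => g.2.2 k (ξ k))), g.2.2 t (ξ t))) (by fun_prop) (by fun_prop)) h2

/-- The noise `v t` is included because the measurement it perturbs is processed before `w t`
enters. -/
lemma Primitives.indepFun_past_w (ξ : ℕ → 𝒳) (t : ℕ) :
    IndepFun (fun ω => (R.past ξ t ω, R.v t (ξ t) ω)) (R.w t) P := by
  have := R.measurable_y₁
  have := R.measurable_z₀
  have := R.measurable_w
  have := R.measurable_v
  have h0 : IndepFun (fun ω (k : Fin t) => R.w k ω) (R.w t) P :=
    iIndepFun.indepFun_prefix R.iIndep_w R.measurable_w t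
  have h1 : IndepFun (fun ω => (fun k => R.v k (ξ k) ω, fun (k : Fin t) => R.w k ω))
      (R.w t) P :=
    indepFun_prodMk_left_of_indepFun_prodMk (by fun_prop) (by fun_prop) (by fun_prop)
      (R.indep_w_v.symm.comp (φ := fun (g : ℕ → 𝒳 → Vec nz) k => g k (ξ k))
        (ψ := fun g : ℕ → Vec ny => (fun k : Fin t => g k, g t)) (by fun_prop) (by fun_prop)) h0
  have h2 := indepFun_prodMk_left_of_indepFun_prodMk (by fun_prop) (by fun_prop) (by fun_prop)
      (R.indep_z₀.comp (φ := id) (ψ := fun g : (ℕ → Vec ny) × (ℕ → 𝒳 → Vec nz) => ((fun k => g.2 k (ξ k),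
        fun k : Fin t => g.1 k), g.1 t)) (by fun_prop) (by fun_prop)) h1
  have h3 := indepFun_prodMk_left_of_indepFun_prodMk (by fun_prop) (by fun_prop) (by fun_prop)
      (R.indep_y₁.comp (φ := id)
        (ψ := fun g : Vec nz × ((ℕ → Vec ny) × (ℕ → 𝒳 → Vec nz)) => ((g.1, (fun k => g.2.2 k (ξ k),
        fun k : Fin t => g.2.1 k)), g.2.1 t)) (by fun_prop) (by fun_prop)) h2
  exact h3.comp (φ := fun p => ((p.1, (p.2.1, (p.2.2.2, fun k : Fin t => p.2.2.1 k))),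
    p.2.2.1 t)) (ψ := id) (by fun_prop) measurable_id

/-- The Kalman filter: the prediction error is a centred Gaussian vector with the Riccati
covariance, independent of the signals received. -/
theorem Primitives.error_law (hSig₀ : Sig₀.PosSemidef) (ξ : ℕ → 𝒳) (t : ℕ) :
    P.map (R.error ξ t) = multivariateGaussian 0 (S.covAlong Sig₀ ξ t) ∧
      IndepFun (R.error ξ t) (R.signals ξ t) P := by
  induction t with
  | zero =>
    constructor
    · have h := map_affine R.measurable_y₁ hSig₀ R.law_y₁ 1 (-m)
      simp only [one_act, neg_add_cancel, Matrix.one_mul, transpose_one, Matrix.mul_one] at h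
      rw [Model.covAlong, ← h]
      congr 1
      ext1 ω
      rw [error, target, Model.predictor, sub_eq_neg_add]
    · exact R.indep_y₁.comp (φ := fun y => y - m) (ψ := fun p => (p.1, fun k : Fin 0 => k.elim0))
        (by fun_prop) (by fun_prop) |>.congr (Filter.Eventually.of_forall fun ω => rfl)
        (Filter.Eventually.of_forall fun ω => Prod.ext rfl (funext fun k => k.elim0))
  | succ t ih =>
    obtain ⟨hlaw, hind⟩ := ih
    set Q := S.covAlong Sig₀ ξ t with hQ
    have hQp : Q.PosSemidef := S.posSemidef_covAlong hSig₀ ξ t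
    have me := R.measurable_error ξ t
    have mv := R.measurable_v t (ξ t)
    have mw := R.measurable_w t
    have ms := R.measurable_signals ξ t
    -- `ν` is the innovation and `e'` the filtered error. The gain makes them uncorrelated, hence
    -- independent, since both are linear images of the same independent Gaussian pair.
    set ν : Ω → Vec nz := fun ω => act (S.H (ξ t)) (R.error ξ t ω) + act 1 (R.v t (ξ t) ω) with hν
    set e' : Ω → Vec ny := fun ω => act (S.contraction (ξ t) Q) (R.error ξ t ω) +
      act (-S.gain (ξ t) Q) (R.v t (ξ t) ω) with he'
    have mν : Measurable ν := by fun_prop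
    have me' : Measurable e' := by fun_prop
    have hev : IndepFun (R.error ξ t) (R.v t (ξ t)) P :=
      IndepFun.of_measurable_comap (R.indepFun_past_v ξ t) (R.measurable_past_error ξ t)
    have hesv : IndepFun (fun ω => (R.error ξ t ω, R.signals ξ t ω)) (R.v t (ξ t)) P :=
      IndepFun.of_measurable_comap (R.indepFun_past_v ξ t)
        ((R.measurable_past_error ξ t).prodMk (R.measurable_past_signals ξ t))
    have hVp := (S.posDef_V (ξ t)).posSemidef
    have he'law : P.map e' = multivariateGaussian 0 (S.update (ξ t) Q) := by
      have h := map_affine_add me mv hev hQp hVp hlaw (R.law_v t (ξ t)) (S.contraction (ξ t) Q)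
        (-S.gain (ξ t) Q)
      simp only [act_zero, add_zero, transpose_neg, Matrix.neg_mul, Matrix.mul_neg, neg_neg] at h
      rw [S.update_eq_joseph _ hQp, ← h]
    have he'ν : IndepFun e' ν P := by
      refine indepFun_act_add_act me mv hev hQp hVp hlaw (R.law_v t (ξ t)) _ _ _ _ ?_
      rw [S.contraction_mul_cross _ hQp, transpose_one, Matrix.mul_one, Matrix.neg_mul,
        add_neg_cancel]
    have hνe's : IndepFun (fun ω => (ν ω, e' ω)) (R.signals ξ t) P :=
      (indepFun_prodMk_left_of_indepFun_prodMk mv me ms hesv.symm hind).comp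
        (φ := fun p : Vec nz × Vec ny => (act (S.H (ξ t)) p.2 + act 1 p.1,
          act (S.contraction (ξ t) Q) p.2 + act (-S.gain (ξ t) Q) p.1)) (ψ := id)
        (by fun_prop) measurable_id
    -- The filtered error is independent of the old signals and the innovation together: the pair
    -- `(ν, e')` is independent of the signals, and `e'` of `ν`.
    have hsν : IndepFun (fun ω => (R.signals ξ t ω, ν ω)) e' P :=
      indepFun_prodMk_left_of_indepFun_prodMk ms mν me' hνe's.symm he'ν.symm
    have hw : IndepFun (fun ω => (e' ω, (R.signals ξ t ω, ν ω))) (R.w t) P := by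
      have hp : Measurable[MeasurableSpace.comap
          (fun ω => (R.past ξ t ω, R.v t (ξ t) ω)) inferInstance]
          (fun ω => ((R.error ξ t ω, R.signals ξ t ω), R.v t (ξ t) ω)) := by
        have hle : MeasurableSpace.comap (R.past ξ t) inferInstance ≤
            MeasurableSpace.comap (fun ω => (R.past ξ t ω, R.v t (ξ t) ω)) inferInstance := by
          have h : R.past ξ t = Prod.fst ∘ fun ω => (R.past ξ t ω, R.v t (ξ t) ω) := rfl
          conv_lhs => rw [h, ← MeasurableSpace.comap_comp]
          exact MeasurableSpace.comap_mono (Measurable.comap_le measurable_fst)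
        exact Measurable.prodMk (((R.measurable_past_error ξ t).prodMk
          (R.measurable_past_signals ξ t)).mono hle le_rfl)
          (measurable_snd.comp (comap_measurable _))
      exact (IndepFun.of_measurable_comap (R.indepFun_past_w ξ t) hp).comp
        (φ := fun p : (Vec ny × (Vec nz × (Fin t → Vec nz))) × Vec nz =>
          (act (S.contraction (ξ t) Q) p.1.1 + act (-S.gain (ξ t) Q) p.2,
            (p.1.2, act (S.H (ξ t)) p.1.1 + act 1 p.2))) (ψ := id) (by fun_prop) measurable_id
    have he'w : IndepFun e' (R.w t) P := hw.comp measurable_fst measurable_id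
    have herr : R.error ξ (t + 1) = fun ω => act S.A (e' ω) + act 1 (R.w t ω) :=
      funext fun ω => R.error_succ ξ t ω
    constructor
    · have h := map_affine_add me' mw he'w (S.posSemidef_update _ hQp) S.posSemidef_W he'law
        (R.law_w t) S.A 1
      simp only [act_zero, add_zero, transpose_one, Matrix.mul_one, Matrix.one_mul] at h
      rw [herr, h]
      rfl
    · have h := (indepFun_prodMk_left_of_indepFun_prodMk mw me' (ms.prodMk mν) hw.symm hsν.symm)
      have hpred := Model.measurable_predictor (S := S) (m := m) (Sig₀ := Sig₀) ξ t
      -- The new signals are a function of the old ones and the innovation, because the predicted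
      -- measurement is computed from the old signals.
      have h' := h.comp (φ := fun p : Vec ny × Vec ny => act S.A p.2 + act 1 p.1)
        (ψ := fun q : (Vec nz × (Fin t → Vec nz)) × Vec nz =>
          (q.1.1, (Fin.snoc q.1.2 (act (S.H (ξ t)) (S.predictor m Sig₀ ξ t q.1.2) + q.2) :
            Fin (t + 1) → Vec nz))) (by fun_prop) (by
              refine Measurable.prodMk (by fun_prop) (measurable_pi_lambda _ fun i => ?_)
              refine Fin.lastCases ?_ (fun j => ?_) i
              · simp only [Fin.snoc_last]
                fun_prop
              · simp only [Fin.snoc_castSucc]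
                fun_prop)
      refine h'.congr (Filter.Eventually.of_forall fun ω => (congrFun herr ω).symm)
        (Filter.Eventually.of_forall fun ω => Prod.ext rfl (funext fun i => ?_))
      refine Fin.lastCases ?_ (fun j => ?_) i
      · simp only [Function.comp, Fin.snoc_last, signals]
        exact (R.meas_eq ξ t ω).symm
      · simp only [Function.comp, Fin.snoc_castSucc, signals]
        rfl

lemma Primitives.exists_law_target (hSig₀ : Sig₀.PosSemidef) [Nonempty 𝒳] (t : ℕ) :
    ∃ a : Vec ny, P.map (R.target t) = multivariateGaussian a (S.targetCov Sig₀ t) := by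
  induction t with
  | zero => exact ⟨m, R.law_y₁⟩
  | succ t ih =>
    obtain ⟨a, ha⟩ := ih
    -- Any trajectory serves: the target ignores it, and it is needed only to speak of the past.
    let ξ : ℕ → 𝒳 := fun _ => Classical.arbitrary 𝒳
    have hind : IndepFun (R.target t) (R.w t) P :=
      IndepFun.of_measurable_comap
        ((R.indepFun_past_w ξ t).comp (φ := Prod.fst) measurable_fst measurable_id)
        (R.measurable_past_target ξ t)
    have h := map_affine_add (R.measurable_target t) (R.measurable_w t) hind
      (S.posSemidef_targetCov hSig₀ t) S.posSemidef_W ha (R.law_w t) S.A 1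
    simp only [transpose_one, Matrix.mul_one, Matrix.one_mul, act_zero, add_zero, one_act] at h
    refine ⟨act S.A a, ?_⟩
    rw [Model.targetCov, Function.iterate_succ_apply']
    exact h

end Kalman

/-! ### Feedback policies reduced to fixed trajectories -/

section Feedback

open Matrix

variable {𝒳 𝒰 : Type*} {ny nz : ℕ} {S : Model 𝒳 𝒰 ny nz} {m : Vec ny}
  {Sig₀ : Matrix (Fin ny) (Fin ny) ℝ} {Ω : Type*} [MeasurableSpace Ω] {P : Measure Ω}
  (R : Primitives S m Sig₀ P) (x₀ : 𝒳) {T : ℕ}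

/-- The first `t` of the controls `σ`. -/
def prefixControls (σ : Fin T → 𝒰) (t : ℕ) (h : t ≤ T) : Fin t → 𝒰 := fun i => σ (Fin.castLE h i)

/-- The sensor trajectory `x_{1:T}` under the controls `σ`. -/
def Model.controlledTrajectory (S : Model 𝒳 𝒰 ny nz) (x₀ : 𝒳) (σ : Fin T → 𝒰) : Fin T → 𝒳 :=
  fun t => S.sensorState x₀ (t + 1) (prefixControls σ (t + 1) t.isLt)

/-- Extend a finite trajectory by a constant. -/
def extendTrajectory (x₀ : 𝒳) (x : Fin T → 𝒳) (k : ℕ) : 𝒳 := if h : k < T then x ⟨k, h⟩ else x₀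

/-- Index `t` carries the pose `x_{t+1}`, from which `z_{t+1}` is taken; hence the shift. -/
lemma extendTrajectory_controlledTrajectory (σ : Fin T → 𝒰) {t : ℕ} (h : t < T) :
    extendTrajectory x₀ (S.controlledTrajectory x₀ σ) t =
      S.sensorState x₀ (t + 1) (prefixControls σ (t + 1) h) := by
  rw [extendTrajectory, dif_pos h]
  rfl

lemma Model.filterCov_prefixControls (σ : Fin T → 𝒰) (t : ℕ) (h : t ≤ T) :
    S.filterCov x₀ Sig₀ t (prefixControls σ t h) =
      S.covAlong Sig₀ (extendTrajectory x₀ (S.controlledTrajectory x₀ σ)) t := by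
  induction t with
  | zero => rfl
  | succ t ih =>
    rw [covAlong, extendTrajectory_controlledTrajectory x₀ σ h, ← ih (Nat.le_of_succ_le h)]
    rfl

lemma Model.filterCov_eq_covAlong (σ : Fin T → 𝒰) :
    S.filterCov x₀ Sig₀ T σ =
      S.covAlong Sig₀ (extendTrajectory x₀ (S.controlledTrajectory x₀ σ)) T :=
  S.filterCov_prefixControls x₀ σ T le_rfl

lemma Primitives.trajectory_eq (μ : Policy 𝒰 nz T) (ω : Ω) :
    R.trajectory x₀ μ ω = S.controlledTrajectory x₀ (R.controls x₀ μ ω) := rfl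

/-- `z_{0:t}` from the pair `(z₀, z_{1:T})`. -/
def prefixSignals {β : Type*} (p : β × (Fin T → β)) (t : ℕ) (h : t ≤ T) : Fin (t + 1) → β :=
  fun i => (Fin.cons p.1 p.2 : Fin (T + 1) → β) (Fin.castLE (Nat.succ_le_succ h) i)

/-- The policy `μ` selects the controls `σ` when the signals received are `p = (z₀, z_{1:T})`. -/
def Policy.Selects (μ : Policy 𝒰 nz T) (σ : Fin T → 𝒰) (p : Vec nz × (Fin T → Vec nz)) : Prop :=
  ∀ t : Fin T, μ.act t (prefixSignals p t t.isLt.le) (prefixControls σ t t.isLt.le) = σ t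

lemma snoc_prefixControls (σ : Fin T → 𝒰) {t : ℕ} (h : t < T) :
    (Fin.snoc (prefixControls σ t h.le) (σ ⟨t, h⟩) : Fin (t + 1) → 𝒰) =
      prefixControls σ (t + 1) h := by
  funext i
  refine Fin.lastCases ?_ (fun j => ?_) i
  · rw [Fin.snoc_last]
    rfl
  · rw [Fin.snoc_castSucc]
    rfl

lemma snoc_prefixSignals {β : Type*} (p : β × (Fin T → β)) {t : ℕ} (h : t < T) :
    (Fin.snoc (prefixSignals p t h.le) (p.2 ⟨t, h⟩) : Fin (t + 1 + 1) → β) =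
      prefixSignals p (t + 1) h := by
  funext i
  refine Fin.lastCases ?_ (fun j => ?_) i
  · rw [Fin.snoc_last]
    rfl
  · rw [Fin.snoc_castSucc]
    rfl

lemma Primitives.history_succ_eq (μ : Policy 𝒰 nz T) (σ : Fin T → 𝒰) (ω : Ω) {t : ℕ} (h : t < T)
    (hpast : R.history x₀ μ ω t h.le = (prefixSignals (R.signals
      (extendTrajectory x₀ (S.controlledTrajectory x₀ σ)) T ω) t h.le, prefixControls σ t h.le))
    (hact : μ.act ⟨t, h⟩ (prefixSignals (R.signals
      (extendTrajectory x₀ (S.controlledTrajectory x₀ σ)) T ω) t h.le) (prefixControls σ t h.le) =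
        σ ⟨t, h⟩) :
    R.history x₀ μ ω (t + 1) h = (prefixSignals (R.signals
      (extendTrajectory x₀ (S.controlledTrajectory x₀ σ)) T ω) (t + 1) h,
        prefixControls σ (t + 1) h) := by
  have e : S.sensorState x₀ (t + 1) (prefixControls σ (t + 1) h) =
    extendTrajectory x₀ (S.controlledTrajectory x₀ σ) t :=
      (extendTrajectory_controlledTrajectory x₀ σ h).symm
  simp only [history, hpast, hact, snoc_prefixControls, e]
  rw [← snoc_prefixSignals _ h]
  rfl

/-- As long as the policy selects the controls `σ`, the history is the open-loop one. -/
lemma Primitives.history_eq (μ : Policy 𝒰 nz T) (σ : Fin T → 𝒰) (ω : Ω)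
    {t : ℕ} (h : t ≤ T) (hsel : ∀ s (hs : s < t), μ.act ⟨s, hs.trans_le h⟩ (prefixSignals (R.signals
      (extendTrajectory x₀ (S.controlledTrajectory x₀ σ)) T ω) s (hs.le.trans h))
        (prefixControls σ s (hs.le.trans h)) = σ ⟨s, hs.trans_le h⟩) :
    R.history x₀ μ ω t h = (prefixSignals (R.signals
      (extendTrajectory x₀ (S.controlledTrajectory x₀ σ)) T ω) t h, prefixControls σ t h) := by
  induction t with
  | zero =>
    refine Prod.ext (funext fun i => ?_) (funext fun i => i.elim0)
    rw [Fin.fin_one_eq_zero i]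
    rfl
  | succ t ih =>
    exact R.history_succ_eq x₀ μ σ ω h
      (ih (Nat.le_of_succ_le h) fun s hs => hsel s (hs.trans t.lt_succ_self))
      (hsel t t.lt_succ_self)

/-- Inductively, agreement of the earlier controls makes the history the open-loop one, so the
latest choice was also made on the open-loop signals. -/
lemma Primitives.selects_of_history (μ : Policy 𝒰 nz T) (σ : Fin T → 𝒰) (ω : Ω)
    {t : ℕ} (h : t ≤ T) (hh : (R.history x₀ μ ω t h).2 = prefixControls σ t h) :
    ∀ s (hs : s < t), μ.act ⟨s, hs.trans_le h⟩ (prefixSignals (R.signals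
      (extendTrajectory x₀ (S.controlledTrajectory x₀ σ)) T ω) s (hs.le.trans h))
        (prefixControls σ s (hs.le.trans h)) = σ ⟨s, hs.trans_le h⟩ := by
  induction t with
  | zero => exact fun s hs => absurd hs s.not_lt_zero
  | succ t ih =>
    have ht : t < T := h
    rw [← snoc_prefixControls σ ht] at hh
    simp only [history] at hh
    obtain ⟨h1, h2⟩ := Fin.snoc_inj.1 hh
    have hpre := ih ht.le h1
    have hhist := R.history_eq x₀ μ σ ω ht.le hpre
    intro s hs
    rcases Nat.lt_succ_iff_lt_or_eq.1 hs with hlt | rfl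
    · exact hpre s hlt
    · rwa [hhist] at h2

/-- The crux of the feedback argument: the right side involves only signals along a deterministic
trajectory, to which the Kalman filter applies. -/
lemma Primitives.controls_eq_iff (μ : Policy 𝒰 nz T) (σ : Fin T → 𝒰) (ω : Ω) :
    R.controls x₀ μ ω = σ ↔ μ.Selects σ (R.signals
      (extendTrajectory x₀ (S.controlledTrajectory x₀ σ)) T ω) := by
  constructor
  · exact fun h t => R.selects_of_history x₀ μ σ ω le_rfl h t t.isLt
  · intro h
    rw [controls, R.history_eq x₀ μ σ ω le_rfl fun s hs => h ⟨s, hs⟩]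
    rfl

lemma Primitives.measurements_eq (μ : Policy 𝒰 nz T) (ω : Ω) :
    R.measurements x₀ μ ω =
      (R.signals (extendTrajectory x₀ (R.trajectory x₀ μ ω)) T ω).2 := by
  have h := (R.controls_eq_iff x₀ μ (R.controls x₀ μ ω) ω).1 rfl
  rw [measurements, R.history_eq x₀ μ (R.controls x₀ μ ω) ω le_rfl fun s hs => h ⟨s, hs⟩]
  rfl

lemma Primitives.trajectory_openLoop (σ : Fin T → 𝒰) :
    R.trajectory x₀ (Policy.openLoop σ) = fun _ => S.controlledTrajectory x₀ σ := by
  funext ω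
  rw [trajectory_eq, (R.controls_eq_iff x₀ (Policy.openLoop σ) σ ω).2 fun _ => rfl]

lemma Policy.measurableSet_selects (μ : Policy 𝒰 nz T) (σ : Fin T → 𝒰) :
    MeasurableSet {p | μ.Selects σ p} := by
  simp only [Selects, Set.ofPred_forall]
  refine MeasurableSet.iInter fun t => ?_
  have h : Measurable fun p : Vec nz × (Fin T → Vec nz) => prefixSignals p t t.isLt.le := by
    refine measurable_pi_lambda _ fun i => ?_
    unfold prefixSignals
    induction Fin.castLE (Nat.succ_le_succ t.isLt.le) i using Fin.cases with
    | zero => exact measurable_fst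
    | succ j => exact (measurable_pi_apply j).comp measurable_snd
  exact h (μ.measurable_act t (prefixControls σ t t.isLt.le) (σ t))

/-- The signals along `x` for which the policy `μ` follows the trajectory `x`. -/
def Policy.followSet (S : Model 𝒳 𝒰 ny nz) (x₀ : 𝒳) (μ : Policy 𝒰 nz T) (x : Fin T → 𝒳) :
    Set (Vec nz × (Fin T → Vec nz)) :=
  ⋃ (σ : Fin T → 𝒰) (_ : S.controlledTrajectory x₀ σ = x), {p | μ.Selects σ p}

/-- Several control sequences may produce `x`, but all of them yield the same signals, so the fibre
is still an event of the signals along `x`. -/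
lemma Primitives.preimage_trajectory (μ : Policy 𝒰 nz T) (x : Fin T → 𝒳) :
    R.trajectory x₀ μ ⁻¹' {x} =
      R.signals (extendTrajectory x₀ x) T ⁻¹' μ.followSet S x₀ x := by
  ext ω
  simp only [Set.mem_preimage, Set.mem_singleton_iff, Policy.followSet, Set.mem_iUnion,
    Set.mem_ofPred_eq, exists_prop]
  constructor
  · intro h
    refine ⟨R.controls x₀ μ ω, h, ?_⟩
    rw [← h]
    exact (R.controls_eq_iff x₀ μ _ ω).1 rfl
  · rintro ⟨σ, rfl, h⟩
    rw [trajectory_eq, (R.controls_eq_iff x₀ μ σ ω).2 h]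

variable [Finite 𝒰]

lemma Policy.measurableSet_followSet (μ : Policy 𝒰 nz T) (x : Fin T → 𝒳) :
    MeasurableSet (μ.followSet S x₀ x) :=
  MeasurableSet.iUnion fun σ => MeasurableSet.iUnion fun _ => μ.measurableSet_selects σ

lemma Primitives.finite_range_trajectory (μ : Policy 𝒰 nz T) :
    (Set.range (R.trajectory x₀ μ)).Finite :=
  (Set.finite_range (S.controlledTrajectory (T := T) x₀)).subset
    (Set.range_subset_iff.2 fun ω => ⟨R.controls x₀ μ ω, rfl⟩)

lemma Primitives.measurableSet_fiber (μ : Policy 𝒰 nz T) (x : Fin T → 𝒳) :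
    MeasurableSet (R.trajectory x₀ μ ⁻¹' {x}) := by
  rw [R.preimage_trajectory]
  exact R.measurable_signals _ _ (μ.measurableSet_followSet x₀ x)

/-- Finitely many values with measurable fibres suffice, whatever the σ-algebra on `𝒳`. -/
lemma Primitives.measurable_trajectory [MeasurableSpace 𝒳] (μ : Policy 𝒰 nz T) :
    Measurable (R.trajectory x₀ μ) := by
  intro s _
  have h : R.trajectory x₀ μ ⁻¹' s =
      ⋃ x ∈ Set.range (R.trajectory x₀ μ) ∩ s, R.trajectory x₀ μ ⁻¹' {x} := by
    ext ω
    simp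
  rw [h]
  exact ((R.finite_range_trajectory x₀ μ).inter_of_left s).measurableSet_biUnion
    fun x _ => R.measurableSet_fiber x₀ μ x

lemma Primitives.measurable_measurements (μ : Policy 𝒰 nz T) :
    Measurable (R.measurements x₀ μ) := by
  intro s hs
  have h : R.measurements x₀ μ ⁻¹' s = ⋃ x ∈ Set.range (R.trajectory x₀ μ),
      (R.trajectory x₀ μ ⁻¹' {x} ∩ (fun ω => (R.signals (extendTrajectory x₀ x) T ω).2) ⁻¹' s) := by
    ext ω
    simp only [Set.mem_preimage, R.measurements_eq x₀ μ ω, Set.mem_iUnion, Set.mem_inter_iff,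
      Set.mem_singleton_iff, exists_prop]
    constructor
    · exact fun hω => ⟨_, ⟨ω, rfl⟩, rfl, hω⟩
    · rintro ⟨x, -, rfl, hω⟩
      exact hω
  rw [h]
  exact (R.finite_range_trajectory x₀ μ).measurableSet_biUnion fun x _ =>
    (R.measurableSet_fiber x₀ μ x).inter ((R.measurable_signals _ _).snd hs)

/-- Under a feedback policy the target and the measurements form a Gaussian channel given the
trajectory, whose error covariance does not depend on the policy. -/
lemma Primitives.isGaussianChannel [IsProbabilityMeasure P] (hSig₀ : Sig₀.PosSemidef)
    (μ : Policy 𝒰 nz T) :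
    IsGaussianChannel P (R.target T) (R.measurements x₀ μ) (R.trajectory x₀ μ)
      (fun x => S.predictor m Sig₀ (extendTrajectory x₀ x) T)
      (fun x => S.covAlong Sig₀ (extendTrajectory x₀ x) T) where
  measurable_pred x := Model.measurable_predictor _ T
  posSemidef_cov x := S.posSemidef_covAlong hSig₀ _ T
  lintegral_fiber x g hg := by
    set ξ := extendTrajectory x₀ x
    obtain ⟨hlaw, hind⟩ := R.error_law hSig₀ ξ T
    have hm := R.measurableSet_fiber x₀ μ x
    have hB := μ.measurableSet_followSet (S := S) x₀ x
    have hZ : ∀ ω ∈ R.trajectory x₀ μ ⁻¹' {x},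
        R.measurements x₀ μ ω = (R.signals ξ T ω).2 := by
      intro ω hω
      rw [R.measurements_eq, show R.trajectory x₀ μ ω = x from hω]
    have hs := R.measurable_signals ξ T
    have he := R.measurable_error ξ T
    have h1 : ∫⁻ ω in R.trajectory x₀ μ ⁻¹' {x}, g (R.measurements x₀ μ ω, R.target T ω -
        S.predictor m Sig₀ ξ T (R.measurements x₀ μ ω)) ∂P =
        ∫⁻ ω in R.trajectory x₀ μ ⁻¹' {x}, g ((R.signals ξ T ω).2, R.error ξ T ω) ∂P := by
      refine setLIntegral_congr_fun hm fun ω hω => ?_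
      simp only [hZ ω hω]
      rfl
    have h2 : ∫⁻ ω in R.trajectory x₀ μ ⁻¹' {x}, ∫⁻ e, g (R.measurements x₀ μ ω, e)
        ∂(multivariateGaussian 0 (S.covAlong Sig₀ ξ T)) ∂P =
        ∫⁻ ω in R.trajectory x₀ μ ⁻¹' {x}, ∫⁻ e, g ((R.signals ξ T ω).2, e)
        ∂(multivariateGaussian 0 (S.covAlong Sig₀ ξ T)) ∂P := by
      refine setLIntegral_congr_fun hm fun ω hω => ?_
      simp only [hZ ω hω]
    rw [h1, h2, ← lintegral_indicator hm, ← lintegral_indicator hm]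
    -- The fibre is absorbed into the integrand as an event of the signals. Both sides then
    -- integrate `G` against the product of the laws of signals and error.
    let G : (Vec nz × (Fin T → Vec nz)) × Vec ny → ℝ≥0∞ :=
      (Prod.fst ⁻¹' μ.followSet S x₀ x).indicator fun q => g (q.1.2, q.2)
    have hG : Measurable G := Measurable.indicator (by fun_prop) (measurable_fst hB)
    have hjoint := (indepFun_iff_map_prod_eq_prod_map_map hs.aemeasurable he.aemeasurable).1
      hind.symm
    have h3 : ∀ ω, (R.trajectory x₀ μ ⁻¹' {x}).indicator
        (fun ω => g ((R.signals ξ T ω).2, R.error ξ T ω)) ω =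
        G (R.signals ξ T ω, R.error ξ T ω) := by
      intro ω
      rw [R.preimage_trajectory]
      rfl
    have h4 : ∀ ω, (R.trajectory x₀ μ ⁻¹' {x}).indicator
        (fun ω => ∫⁻ e, g ((R.signals ξ T ω).2, e)
          ∂(multivariateGaussian 0 (S.covAlong Sig₀ ξ T))) ω =
        ∫⁻ e, G (R.signals ξ T ω, e) ∂(multivariateGaussian 0 (S.covAlong Sig₀ ξ T)) := by
      intro ω
      rw [R.preimage_trajectory]
      by_cases hω : R.signals ξ T ω ∈ μ.followSet S x₀ x
      · rw [Set.indicator_of_mem (Set.mem_preimage.2 hω)]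
        have h1 : ∀ e, G (R.signals ξ T ω, e) = g ((R.signals ξ T ω).2, e) := fun e =>
          Set.indicator_of_mem (s := Prod.fst ⁻¹' μ.followSet S x₀ x)
            (a := (R.signals ξ T ω, e)) hω _
        simp only [h1]
      · rw [Set.indicator_of_notMem (show ω ∉ R.signals ξ T ⁻¹' μ.followSet S x₀ x from hω)]
        have h0 : ∀ e, G (R.signals ξ T ω, e) = 0 := fun e => Set.indicator_of_notMem
          (s := Prod.fst ⁻¹' μ.followSet S x₀ x) (a := (R.signals ξ T ω, e)) hω _
        simp only [h0, lintegral_zero]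
    simp_rw [h3, h4]
    rw [← lintegral_map (f := G) (g := fun ω => (R.signals ξ T ω, R.error ξ T ω)) hG
      (by fun_prop), hjoint, lintegral_prod _ hG.aemeasurable, hlaw,
      lintegral_map (f := fun s => ∫⁻ e, G (s, e)
        ∂(multivariateGaussian 0 (S.covAlong Sig₀ ξ T))) (hG.lintegral_prod_right') hs]

/-! ### Comparison of policies with open-loop controls -/

section Objective

variable [MeasurableSpace 𝒳] [MeasurableSingletonClass 𝒳] [IsProbabilityMeasure P] {r : ℕ}
  {L : Matrix (Fin ny) (Fin r) ℝ} {B : Matrix (Fin r) (Fin ny) ℝ}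

/-- The information about the whitened target gained by the controls `σ`. -/
noncomputable def Model.controlInfo (S : Model 𝒳 𝒰 ny nz) (Sig₀ : Matrix (Fin ny) (Fin ny) ℝ)
    (x₀ : 𝒳) (B : Matrix (Fin r) (Fin ny) ℝ) (σ : Fin T → 𝒰) : ℝ :=
  -(Real.log (B * S.filterCov x₀ Sig₀ T σ * Bᵀ).det) / 2

lemma mul_mul_transpose_eq_one {Q : Matrix (Fin ny) (Fin ny) ℝ} (hLS : L * Lᵀ = Q)
    (hBL : B * L = 1) : B * Q * Bᵀ = 1 := by
  rw [← hLS, ← Matrix.mul_assoc, hBL, Matrix.one_mul, ← transpose_mul, hBL, transpose_one]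

lemma Primitives.objective_le (hSig₀ : Sig₀.PosSemidef) (hLS : L * Lᵀ = S.targetCov Sig₀ T)
    (hBL : B * L = 1) (μ : Policy 𝒰 nz T) :
    R.objective x₀ μ ≠ ∞ ∧
      (R.objective x₀ μ).toReal ≤ ∫ ω, S.controlInfo Sig₀ x₀ B (R.controls x₀ μ ω) ∂P := by
  have : Nonempty 𝒳 := ⟨x₀⟩
  obtain ⟨a, ha⟩ := R.exists_law_target hSig₀ T
  have h := (R.isGaussianChannel x₀ hSig₀ μ).condMutualInfo_le (R.measurable_target T)
    (R.measurable_measurements x₀ μ) (R.measurable_trajectory x₀ μ)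
    (R.finite_range_trajectory x₀ μ) ha hLS hBL fun x =>
      S.posDef_mul_covAlong_mul hSig₀ _ T (mul_mul_transpose_eq_one hLS hBL)
  simpa only [objective, Model.controlInfo, Model.filterCov_eq_covAlong, trajectory_eq] using h

lemma Primitives.objective_openLoop (hSig₀ : Sig₀.PosSemidef)
    (hLS : L * Lᵀ = S.targetCov Sig₀ T) (hBL : B * L = 1) (σ : Fin T → 𝒰) :
    R.objective x₀ (Policy.openLoop σ) ≠ ∞ ∧
      (R.objective x₀ (Policy.openLoop σ)).toReal = S.controlInfo Sig₀ x₀ B σ := by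
  have : Nonempty 𝒳 := ⟨x₀⟩
  obtain ⟨a, ha⟩ := R.exists_law_target hSig₀ T
  have hch := R.isGaussianChannel x₀ hSig₀ (Policy.openLoop σ)
  rw [R.trajectory_openLoop] at hch
  have h := hch.condMutualInfo_eq (R.measurable_target T)
    (R.measurable_measurements x₀ _) ha hLS hBL fun x =>
      S.posDef_mul_covAlong_mul hSig₀ _ T (mul_mul_transpose_eq_one hLS hBL)
  rwa [objective, R.trajectory_openLoop, Model.controlInfo, Model.filterCov_eq_covAlong]

lemma Primitives.integrable_controlInfo (μ : Policy 𝒰 nz T) :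
    Integrable (fun ω => S.controlInfo Sig₀ x₀ B (R.controls x₀ μ ω)) P := by
  simp only [Model.controlInfo, Model.filterCov_eq_covAlong]
  exact integrable_comp_of_finite_range (R.measurable_trajectory x₀ μ)
    (R.finite_range_trajectory x₀ μ) fun x =>
      -(Real.log (B * S.covAlong Sig₀ (extendTrajectory x₀ x) T * Bᵀ).det) / 2

/-- Open-loop controls attain their `controlInfo`, and any policy is worth at most an average of
such values, hence at most their maximum. -/
lemma Primitives.isOptimal_openLoop_iff (hSig₀ : Sig₀.PosSemidef)
    (hLS : L * Lᵀ = S.targetCov Sig₀ T) (hBL : B * L = 1) (σ : Fin T → 𝒰) :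
    R.IsOptimal x₀ (Policy.openLoop σ) ↔
      ∀ τ : Fin T → 𝒰, S.controlInfo Sig₀ x₀ B τ ≤ S.controlInfo Sig₀ x₀ B σ := by
  obtain ⟨hσ, hσ'⟩ := R.objective_openLoop x₀ hSig₀ hLS hBL σ
  constructor
  · intro h τ
    rw [← hσ', ← (R.objective_openLoop x₀ hSig₀ hLS hBL τ).2]
    exact ENNReal.toReal_mono hσ (h _)
  · intro h μ
    obtain ⟨hμ, hμ'⟩ := R.objective_le x₀ hSig₀ hLS hBL μ
    rw [← ENNReal.toReal_le_toReal hμ hσ, hσ']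
    refine hμ'.trans ?_
    have := integral_mono (R.integrable_controlInfo x₀ (B := B) μ)
      (integrable_const (S.controlInfo Sig₀ x₀ B σ)) fun ω => h (R.controls x₀ μ ω)
    simpa using this

variable [Nonempty 𝒰]

lemma Primitives.exists_isOptimal_openLoop (hSig₀ : Sig₀.PosSemidef) :
    ∃ σ : Fin T → 𝒰, R.IsOptimal x₀ (Policy.openLoop σ) := by
  obtain ⟨r, L, B, hLS, hBL⟩ := exists_whitening (S.posSemidef_targetCov hSig₀ T)
  obtain ⟨σ, hσ⟩ := Finite.exists_max fun σ : Fin T → 𝒰 => S.controlInfo Sig₀ x₀ B σ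
  exact ⟨σ, (R.isOptimal_openLoop_iff x₀ hSig₀ hLS hBL σ).2 hσ⟩

/-- The gap between the maximum and the value of the applied controls is nonnegative. Optimality
forces its mean to be zero, so it vanishes almost surely. -/
lemma Primitives.ae_controlInfo_max (hSig₀ : Sig₀.PosSemidef)
    (hLS : L * Lᵀ = S.targetCov Sig₀ T) (hBL : B * L = 1) {μ : Policy 𝒰 nz T}
    (hμ : R.IsOptimal x₀ μ) :
    ∀ᵐ ω ∂P, ∀ τ : Fin T → 𝒰,
      S.controlInfo Sig₀ x₀ B τ ≤ S.controlInfo Sig₀ x₀ B (R.controls x₀ μ ω) := by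
  obtain ⟨σ, hσ⟩ := Finite.exists_max fun σ : Fin T → 𝒰 => S.controlInfo Sig₀ x₀ B σ
  obtain ⟨h1, h2⟩ := R.objective_le x₀ hSig₀ hLS hBL μ
  have h3 := ENNReal.toReal_mono h1 (hμ (Policy.openLoop σ))
  rw [(R.objective_openLoop x₀ hSig₀ hLS hBL σ).2] at h3
  have hi := R.integrable_controlInfo x₀ (B := B) μ
  have hi' : Integrable (fun ω => S.controlInfo Sig₀ x₀ B σ -
    S.controlInfo Sig₀ x₀ B (R.controls x₀ μ ω)) P := (integrable_const _).sub hi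
  have h0 : ∫ ω, (S.controlInfo Sig₀ x₀ B σ -
      S.controlInfo Sig₀ x₀ B (R.controls x₀ μ ω)) ∂P = 0 := by
    refine le_antisymm ?_ (integral_nonneg fun ω => sub_nonneg.2 (hσ _))
    rw [integral_sub (integrable_const _) hi]
    simpa using h3.trans h2
  filter_upwards [(integral_eq_zero_iff_of_nonneg (fun ω => sub_nonneg.2 (hσ _)) hi').1 h0]
    with ω hω τ
  have : S.controlInfo Sig₀ x₀ B σ - S.controlInfo Sig₀ x₀ B (R.controls x₀ μ ω) = 0 := hω
  linarith [hσ τ]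

end Objective

open scoped MatrixOrder in
-- A square `B` is needed so that `det (B Σ Bᵀ)` splits into determinants.
lemma exists_square_whitening {n : ℕ} {Q : Matrix (Fin n) (Fin n) ℝ} (hQ : Q.PosDef) :
    ∃ L B : Matrix (Fin n) (Fin n) ℝ, L * Lᵀ = Q ∧ B * L = 1 := by
  have hLL : CFC.sqrt Q * CFC.sqrt Q = Q := CFC.sqrt_mul_sqrt_self Q hQ.posSemidef.nonneg
  have hLT : (CFC.sqrt Q)ᵀ = CFC.sqrt Q := by
    have := (CFC.sqrt_nonneg Q).posSemidef.1.eq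
    rwa [conjTranspose_eq_transpose_of_trivial] at this
  refine ⟨CFC.sqrt Q, (CFC.sqrt Q)⁻¹, by rw [hLT, hLL], nonsing_inv_mul _ ?_⟩
  refine isUnit_iff_ne_zero.2 fun h => hQ.det_pos.ne' ?_
  rw [← hLL, det_mul, h, zero_mul]

omit [Finite 𝒰] in
-- From `B S Bᵀ = 1` one gets `(det B)² = (det S)⁻¹`, so whitening only shifts the `log det` by a
-- constant.
lemma Model.controlInfo_eq {L B : Matrix (Fin ny) (Fin ny) ℝ} (hSig₀ : Sig₀.PosSemidef)
    (hT : (S.targetCov Sig₀ T).PosDef) (hLS : L * Lᵀ = S.targetCov Sig₀ T) (hBL : B * L = 1)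
    (σ : Fin T → 𝒰) :
    S.controlInfo Sig₀ x₀ B σ = (Real.log (S.targetCov Sig₀ T).det -
      Real.log (S.filterCov x₀ Sig₀ T σ).det) / 2 := by
  have hpos := (S.posDef_covAlong hSig₀
    (extendTrajectory x₀ (S.controlledTrajectory x₀ σ)) T hT).det_pos
  rw [← Model.filterCov_eq_covAlong] at hpos
  have h1 : B.det * B.det * (S.targetCov Sig₀ T).det = 1 := by
    have h := congrArg det (mul_mul_transpose_eq_one hLS hBL)
    rw [det_mul, det_mul, det_transpose, det_one] at h
    linarith
  have hB : B.det * B.det = (S.targetCov Sig₀ T).det⁻¹ := eq_inv_of_mul_eq_one_left h1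
  have h2 : (B * S.filterCov x₀ Sig₀ T σ * Bᵀ).det =
      (S.targetCov Sig₀ T).det⁻¹ * (S.filterCov x₀ Sig₀ T σ).det := by
    rw [← hB, det_mul, det_mul, det_transpose]
    ring
  rw [controlInfo, h2, Real.log_mul (inv_ne_zero hT.det_pos.ne') hpos.ne', Real.log_inv]
  ring

end Feedback

end ActiveInfo

theorem theorem1 {𝒳 𝒰 : Type*} [MeasurableSpace 𝒳] [MeasurableSingletonClass 𝒳]
    [Finite 𝒰] [Nonempty 𝒰] {ny nz : ℕ} (S : ActiveInfo.Model 𝒳 𝒰 ny nz) (x₀ : 𝒳) (T : ℕ)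
    (m : ActiveInfo.Vec ny) (Sig₀ : Matrix (Fin ny) (Fin ny) ℝ) (hSig₀ : Sig₀.PosSemidef)
    {Ω : Type*} [MeasurableSpace Ω] (P : Measure Ω) [IsProbabilityMeasure P]
    (R : ActiveInfo.Primitives S m Sig₀ P) :
    -- some open-loop control sequence is optimal among all feedback policies
    (∃ σ : Fin T → 𝒰, R.IsOptimal x₀ (ActiveInfo.Policy.openLoop σ)) ∧
    -- equivalence with the log det problem, when `y_{T+1}` has a nonsingular covariance
    ((S.targetCov Sig₀ T).PosDef →
      (∀ σ : Fin T → 𝒰,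
        (S.filterCov x₀ Sig₀ T σ).PosDef ∧
        R.objective x₀ (ActiveInfo.Policy.openLoop σ) ≠ ∞ ∧
        (R.objective x₀ (ActiveInfo.Policy.openLoop σ)).toReal =
          (Real.log (S.targetCov Sig₀ T).det - Real.log (S.filterCov x₀ Sig₀ T σ).det) / 2) ∧
      (∀ σ : Fin T → 𝒰,
        R.IsOptimal x₀ (ActiveInfo.Policy.openLoop σ) ↔ S.IsLogDetOptimal x₀ Sig₀ σ) ∧
      (∀ μ : ActiveInfo.Policy 𝒰 nz T, R.IsOptimal x₀ μ →
        ∀ᵐ ω ∂P, S.IsLogDetOptimal x₀ Sig₀ (R.controls x₀ μ ω))) ∧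
    -- the equivalent forms of the Riccati update
    (∀ (x : 𝒳) (Sig : Matrix (Fin ny) (Fin ny) ℝ), Sig.PosSemidef →
      (S.innovCov x Sig).PosDef ∧
      IsUnit (1 + Sig * S.infoMatrix x) ∧
      S.contraction x Sig = (1 + Sig * S.infoMatrix x)⁻¹ ∧
      S.update x Sig =
        S.contraction x Sig * Sig * (S.contraction x Sig).transpose +
          S.gain x Sig * S.V x * (S.gain x Sig).transpose ∧
      (Sig.PosDef →
        (Sig⁻¹ + S.infoMatrix x).PosDef ∧ S.update x Sig = (Sig⁻¹ + S.infoMatrix x)⁻¹)) := by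
  refine ⟨R.exists_isOptimal_openLoop x₀ hSig₀, fun hT => ?_, fun x Sig hSig => ⟨?_, ?_, ?_, ?_, ?_⟩⟩
  · obtain ⟨L, B, hLS, hBL⟩ := ActiveInfo.exists_square_whitening hT
    have hinfo := fun σ : Fin T → 𝒰 =>
      ActiveInfo.Model.controlInfo_eq (S := S) x₀ hSig₀ hT hLS hBL σ
    have hopt : ∀ σ : Fin T → 𝒰, S.IsLogDetOptimal x₀ Sig₀ σ ↔
        ∀ τ : Fin T → 𝒰, S.controlInfo Sig₀ x₀ B τ ≤ S.controlInfo Sig₀ x₀ B σ := by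
      intro σ
      refine forall_congr' fun τ => ?_
      rw [hinfo, hinfo]
      constructor <;> intro h <;> linarith
    refine ⟨fun σ => ⟨?_, ?_, ?_⟩, fun σ => ?_, fun μ hμ => ?_⟩
    · rw [ActiveInfo.Model.filterCov_eq_covAlong]
      exact S.posDef_covAlong hSig₀ _ T hT
    · exact (R.objective_openLoop x₀ hSig₀ hLS hBL σ).1
    · rw [(R.objective_openLoop x₀ hSig₀ hLS hBL σ).2, hinfo]
    · rw [R.isOptimal_openLoop_iff x₀ hSig₀ hLS hBL, hopt]
    · filter_upwards [R.ae_controlInfo_max x₀ hSig₀ hLS hBL hμ] with ω hω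
      exact (hopt _).2 hω
  · exact S.posDef_innovCov x hSig
  · exact S.isUnit_one_add_mul_infoMatrix x hSig
  · exact S.contraction_eq_inv x hSig
  · exact S.update_eq_joseph x hSig
  · exact fun h => ⟨S.posDef_inv_add_infoMatrix x h, S.update_eq_inv x h⟩
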